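/- All rings are unital, not necessarily commutative, and ring homomorphisms preserve $1$; $\mathrm{U}(R)$ is the group of units of $R$. For a subset $S$ of a ring $A$, $A_S=\langle A,\{x_s\}_{s\in S}\mid x_ss=sx_s=1\rangle$ is the universal localization. A ringed space is a topological space with a sheaf of rings. A ring homomorphism $\phi:A\to B$ is local if $\phi^{-1}(\mathrm{U}(B))=\mathrm{U}(A)$, and a morphism $f:X\to Y$ of ringed spaces is local if all $f^\sharp_x:\mathcal O_{Y,f(x)}\to\mathcal O_{X,x}$ are local. *The full spectrum.* A homomorphism $\phi:A\to B$ to a nonzero ring yields a sequence $\mathcal S=(S_1,S_2,\dots)$ by $A_0=A$, $\phi_0=\phi$, $S_{n+1}=\phi_n^{-1}(\mathrm{U}(B))$, $A_{n+1}=(A_n)_{S_{n+1}}$, with $\phi_{n+1}:A_{n+1}\to B$ the extension of $\phi_n$. The sequences so obtained are the fully invertible systems on $A$; $\mathrm F(A)$ is the set of all of them, and $A_{\mathcal S}=\varinjlim_n A_n$, with natural map $i_{\mathcal S}:A\to A_{\mathcal S}$. A fraction of $A$ is a tuple $\mathbf a=(a_1,\dots,a_n)$ with $a_1\in A$, $a_2\in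 A_{a_1}$, $a_3\in (A_{a_1})_{a_2}$, …, and $A_{\mathbf a}=(\dots(A_{a_1})_{a_2}\dots)_{a_n}$; $D(\mathbf a)\subset\mathrm F(A)$ is the set of all $\mathcal S$ such that $a_1,\dots,a_n$ successively become units in $A_{\mathcal S}$, i.e. such that $i_{\mathcal S}$ extends to $A_{\mathbf a}\to A_{\mathcal S}$. The sets $D(\mathbf a)$ generate the topology of $\mathrm F(A)$. The sections over $U$ of the structure sheaf are the functions $t$ on $U$ with $t(\mathcal S)\in A_{\mathcal S}$ which, locally on $U$, are given by an element $b\in A_{\mathbf a}$ for some fraction $\mathbf a$ (on an open set contained in $D(\mathbf a)$, $t(\mathcal S)$ is the image of $b$ in $A_{\mathcal S}$). A homomorphism $\phi:A\to B$ induces a morphism $\mathrm F(\phi):\mathrm F(B)\to\mathrm F(A)$, which sends $\mathcal S$ to the system $\phi^*(\mathcal S)$ coming from $i_{\mathcal S}\circ\phi$ and acts on stalks by the natural maps $A_{\phi^*(\mathcal S)}\to B_{\mathcal S}$. *F-schemes and local points.* An F-scheme is a ringed space which is locally isomorphic to ringed spaces $\mathrm F(A)$; it is commutative if it has an open covering by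 ringed spaces isomorphic to $\mathrm F(A_i)$ with all $A_i$ commutative. Morphisms of F-schemes are the local morphisms of ringed spaces. For a ringed space $X$, $\mathrm L(X)$ is the subspace of all $x\in X$ for which $\mathcal O_{X,x}$ is a local ring, with the restriction (inverse image) of $\mathcal O_X$ as structure sheaf, and $\iota_X:\mathrm L(X)\to X$ is the inclusion. **Statement.** 1. For every commutative ring $A$ there is a local morphism of ringed spaces $f_A:\mathrm{Spec}(A)\to \mathrm F(A)$ which sends a prime ideal $P$ to a fully invertible system with first term $A\setminus P$. It is natural in $A$: for every homomorphism $\phi:A\to B$ of commutative rings, $f_A\circ\mathrm{Spec}(\phi)=\mathrm F(\phi)\circ f_B$. Moreover $f_A$ is an isomorphism of ringed spaces of $\mathrm{Spec}(A)$ onto the ringed subspace of local points of $\mathrm F(A)$: there is an isomorphism $e:\mathrm{Spec}(A)\to \mathrm L(\mathrm F(A))$ with $f_A=\iota_{\mathrm F(A)}\circ e$. 2. The assignment $X\mapsto \mathrm L(X)$ is a functor from the category of commutative F-schemes to the category of schemes, a morphism $g:X\to Y$ being sent to its restriction to local points. That is, there are a functor $\mathcal L$ from commutative F-schemes to schemes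 and, for every commutative F-scheme $X$, an isomorphism of ringed spaces $e_X:\mathcal L(X)\to\mathrm L(X)$ such that $\iota_Y\circ e_Y\circ\mathcal L(g)=g\circ\iota_X\circ e_X$ for every morphism $g:X\to Y$ of commutative F-schemes. -/

import Mathlib

open CategoryTheory Limits TopologicalSpace Opposite AlgebraicGeometry

universe u

noncomputable section

namespace FSch

/-! ## Universal localization of a (possibly noncommutative) ring -/

/-- The relations of the presentation `⟨A, x_s (s ∈ S) | x_s s = s x_s = 1⟩`; the generator
`Sum.inl a` stands for `a ∈ A` and `Sum.inr s` stands for `x_s`. -/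
inductive LocRel (A : Type u) [Ring A] (S : Set A) :
    FreeAlgebra ℤ (A ⊕ S) → FreeAlgebra ℤ (A ⊕ S) → Prop
  | one : LocRel A S (FreeAlgebra.ι ℤ (Sum.inl 1)) 1
  | add (a b : A) : LocRel A S (FreeAlgebra.ι ℤ (Sum.inl (a + b)))
      (FreeAlgebra.ι ℤ (Sum.inl a) + FreeAlgebra.ι ℤ (Sum.inl b))
  | mul (a b : A) : LocRel A S (FreeAlgebra.ι ℤ (Sum.inl (a * b)))
      (FreeAlgebra.ι ℤ (Sum.inl a) * FreeAlgebra.ι ℤ (Sum.inl b))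
  | mul_inv (s : S) : LocRel A S
      (FreeAlgebra.ι ℤ (Sum.inl (s : A)) * FreeAlgebra.ι ℤ (Sum.inr s)) 1
  | inv_mul (s : S) : LocRel A S
      (FreeAlgebra.ι ℤ (Sum.inr s) * FreeAlgebra.ι ℤ (Sum.inl (s : A))) 1

/-- The localization `A_S` of a ring `A` at a subset `S`. -/
def Loc (A : Type u) [Ring A] (S : Set A) : Type u := RingQuot (LocRel A S)

instance instRingLoc (A : Type u) [Ring A] (S : Set A) : Ring (Loc A S) :=
  inferInstanceAs (Ring (RingQuot (LocRel A S)))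

/-- The quotient map from the free ring. -/
def Loc.mk {A : Type u} [Ring A] (S : Set A) : FreeAlgebra ℤ (A ⊕ S) →+* Loc A S :=
  RingQuot.mkRingHom (LocRel A S)

theorem Loc.mk_rel {A : Type u} [Ring A] {S : Set A} {x y : FreeAlgebra ℤ (A ⊕ S)}
    (h : LocRel A S x y) : Loc.mk S x = Loc.mk S y :=
  RingQuot.mkRingHom_rel h

/-- The natural homomorphism `i_S : A → A_S`. -/
def Loc.of {A : Type u} [Ring A] (S : Set A) : A →+* Loc A S :=
  RingHom.mk' ⟨⟨fun a => Loc.mk S (FreeAlgebra.ι ℤ (Sum.inl a)),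
    by rw [Loc.mk_rel LocRel.one, map_one]⟩,
    fun a b => by
      change Loc.mk S _ = Loc.mk S _ * Loc.mk S _
      rw [Loc.mk_rel (LocRel.mul a b), map_mul]⟩
    fun a b => by
      change Loc.mk S _ = Loc.mk S _ + Loc.mk S _
      rw [Loc.mk_rel (LocRel.add a b), map_add]

theorem Loc.isUnit_of {A : Type u} [Ring A] {S : Set A} {s : A} (hs : s ∈ S) :
    IsUnit (Loc.of S s) := by
  refine ⟨⟨Loc.of S s, Loc.mk S (FreeAlgebra.ι ℤ (Sum.inr ⟨s, hs⟩)), ?_, ?_⟩, rfl⟩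
  · change Loc.mk S _ * Loc.mk S _ = 1
    rw [← map_mul, Loc.mk_rel (LocRel.mul_inv ⟨s, hs⟩), map_one]
  · change Loc.mk S _ * Loc.mk S _ = 1
    rw [← map_mul, Loc.mk_rel (LocRel.inv_mul ⟨s, hs⟩), map_one]

/-- The map out of the free ring which induces `Loc.lift`. -/
def Loc.preLift {A B : Type u} [Ring A] [Ring B] {S : Set A} (φ : A →+* B)
    (h : ∀ s ∈ S, IsUnit (φ s)) : FreeAlgebra ℤ (A ⊕ S) →ₐ[ℤ] B :=
  FreeAlgebra.lift ℤ (Sum.elim φ (fun s => ((h s.1 s.2).unit⁻¹ : Bˣ)))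

/-- The universal property of `A_S`: a homomorphism `φ : A → B` which sends `S` into the units
of `B` extends to `A_S`. -/
def Loc.lift {A B : Type u} [Ring A] [Ring B] {S : Set A} (φ : A →+* B)
    (h : ∀ s ∈ S, IsUnit (φ s)) : Loc A S →+* B :=
  RingQuot.lift ⟨(Loc.preLift φ h).toRingHom, fun x y hxy => by
    induction hxy <;> simp [Loc.preLift]⟩

theorem Loc.lift_mk {A B : Type u} [Ring A] [Ring B] {S : Set A} (φ : A →+* B)
    (h : ∀ s ∈ S, IsUnit (φ s)) (x : FreeAlgebra ℤ (A ⊕ S)) :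
    Loc.lift φ h (Loc.mk S x) = Loc.preLift φ h x :=
  RingQuot.lift_mkRingHom_apply _ _ x

@[simp]
theorem Loc.lift_of {A B : Type u} [Ring A] [Ring B] {S : Set A} (φ : A →+* B)
    (h : ∀ s ∈ S, IsUnit (φ s)) (a : A) : Loc.lift φ h (Loc.of S a) = φ a :=
  (Loc.lift_mk φ h _).trans (by simp [Loc.preLift])

theorem Loc.lift_comp_of {A B : Type u} [Ring A] [Ring B] {S : Set A} (φ : A →+* B)
    (h : ∀ s ∈ S, IsUnit (φ s)) : (Loc.lift φ h).comp (Loc.of S) = φ :=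
  RingHom.ext (Loc.lift_of φ h)

/-- The uniqueness part of the universal property of `A_S`. -/
theorem Loc.hom_ext {A B : Type u} [Ring A] [Ring B] {S : Set A} {f g : Loc A S →+* B}
    (h : f.comp (Loc.of S) = g.comp (Loc.of S)) : f = g := by
  have hof : ∀ a, f (Loc.of S a) = g (Loc.of S a) := fun a => RingHom.congr_fun h a
  refine RingQuot.ringQuot_ext f g ?_
  have key : (f.comp (Loc.mk S)).toIntAlgHom = (g.comp (Loc.mk S)).toIntAlgHom := by
    refine FreeAlgebra.hom_ext (funext fun x => ?_)
    rcases x with a | s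
    · exact hof a
    · change f (Loc.mk S (FreeAlgebra.ι ℤ (Sum.inr s))) = g (Loc.mk S (FreeAlgebra.ι ℤ (Sum.inr s)))
      have h1 : Loc.of S (s : A) * Loc.mk S (FreeAlgebra.ι ℤ (Sum.inr s)) = 1 := by
        change Loc.mk S _ * Loc.mk S _ = 1
        rw [← map_mul, Loc.mk_rel (LocRel.mul_inv s), map_one]
      have h2 : Loc.mk S (FreeAlgebra.ι ℤ (Sum.inr s)) * Loc.of S (s : A) = 1 := by
        change Loc.mk S _ * Loc.mk S _ = 1
        rw [← map_mul, Loc.mk_rel (LocRel.inv_mul s), map_one]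
      refine left_inv_eq_right_inv (a := f (Loc.of S (s : A))) ?_ ?_
      · rw [← map_mul, h2, map_one]
      · rw [hof, ← map_mul, h1, map_one]
  refine RingHom.ext fun x => ?_
  exact DFunLike.congr_fun key x

/-! ## Fully invertible systems -/

/-- `(Segs A n).1` is the type of all finite sequences `(S₁, …, Sₙ)` with `S₁ ⊆ A`,
`S₂ ⊆ A_{S₁}`, `S₃ ⊆ (A_{S₁})_{S₂}`, …, and `(Segs A n).2` sends such a sequence to the
iterated localization `(…(A_{S₁})_{S₂}…)_{Sₙ}`. -/
def Segs (A : RingCat.{u}) : ℕ → Σ T : Type u, T → RingCat.{u}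
  | 0 => ⟨PUnit, fun _ => A⟩
  | n + 1 => ⟨Σ t : (Segs A n).1, Set ((Segs A n).2 t),
      fun p => RingCat.of (Loc ((Segs A n).2 p.1) p.2)⟩

/-- Sequences `(S₁, …, Sₙ)` of subsets of iterated localizations. -/
abbrev Seg (A : RingCat.{u}) (n : ℕ) : Type u := (Segs A n).1

/-- The iterated localization of `A` at `(S₁, …, Sₙ)`. -/
abbrev Seg.ring {A : RingCat.{u}} {n : ℕ} (t : Seg A n) : RingCat.{u} := (Segs A n).2 t

/-- The initial segment `(S₁, …, Sₙ)` of `(S₁, …, Sₙ₊₁)`. -/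
abbrev Seg.init {A : RingCat.{u}} {n : ℕ} (t : Seg A (n + 1)) : Seg A n := Sigma.fst t

/-- The last term `Sₙ₊₁` of `(S₁, …, Sₙ₊₁)`. -/
abbrev Seg.last {A : RingCat.{u}} {n : ℕ} (t : Seg A (n + 1)) : Set (Seg.init t).ring :=
  Sigma.snd t

/-- For a homomorphism `φ : A → B`, the first `n` terms `(S₁, …, Sₙ)` of the sequence coming from
`φ`, with the induced homomorphism `φₙ : Aₙ → B`.  Here `A₀ = A`, `φ₀ = φ`,
`Sₙ₊₁ = φₙ⁻¹(U(B))`, `Aₙ₊₁ = (Aₙ)_{Sₙ₊₁}` and `φₙ₊₁` is the extension of `φₙ`. -/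
def stages {A B : RingCat.{u}} (φ : A →+* B) : ∀ n : ℕ, Σ t : Seg A n, (t.ring →+* B)
  | 0 => ⟨PUnit.unit, φ⟩
  | n + 1 => ⟨⟨(stages φ n).1, {x | IsUnit ((stages φ n).2 x)}⟩,
      Loc.lift (stages φ n).2 fun _ hx => hx⟩

/-- A fully invertible system `𝒮 = (S₁, S₂, …)` on `A`, given by its initial segments: a sequence
which comes from some homomorphism from `A` to a nonzero ring.  The type of all of them
is (the underlying set of) the full spectrum of `A`. -/
@[ext]
structure FISystem (A : RingCat.{u}) : Type u where
  /-- the initial segment `(S₁, …, Sₙ)` -/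
  seg : ∀ n : ℕ, Seg A n
  exists_hom : ∃ (B : RingCat.{u}) (_ : Nontrivial B) (φ : A →+* B),
    seg = fun n => (stages φ n).1

namespace FISystem

/-- The fully invertible system coming from `φ : A → B`. -/
def ofHom {A B : RingCat.{u}} [hB : Nontrivial B] (φ : A →+* B) : FISystem A where
  seg n := (stages φ n).1
  exists_hom := ⟨B, hB, φ, rfl⟩

/-- The first term `S₁ ⊆ A` of a fully invertible system. -/
def first {A : RingCat.{u}} (𝒮 : FISystem A) : Set A := Seg.last (𝒮.seg 1)

theorem seg_succ_init {A : RingCat.{u}} (𝒮 : FISystem A) (n : ℕ) :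
    Seg.init (𝒮.seg (n + 1)) = 𝒮.seg n := by
  obtain ⟨_, B, _, φ, rfl⟩ := 𝒮
  rfl

/-- For `t = (S₁, …, Sₙ₊₁)` with initial segment `t'`, the localization map
`A_{t'} → (A_{t'})_{Sₙ₊₁} = A_t`. -/
def segMap {A : RingCat.{u}} {n : ℕ} (t : Seg A (n + 1)) (t' : Seg A n) (h : Seg.init t = t') :
    t'.ring ⟶ t.ring := by
  subst h
  exact RingCat.ofHom (Loc.of (Seg.last t))

/-- The transition map `A_{𝒮,n} → A_{𝒮,n+1}`. -/
def step {A : RingCat.{u}} (𝒮 : FISystem A) (n : ℕ) : (𝒮.seg n).ring ⟶ (𝒮.seg (n + 1)).ring :=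
  segMap _ _ (𝒮.seg_succ_init n)

/-- The direct system `A = A_{𝒮,0} → A_{𝒮,1} → A_{𝒮,2} → …`. -/
def diagram {A : RingCat.{u}} (𝒮 : FISystem A) : ℕ ⥤ RingCat.{u} :=
  Functor.ofSequence 𝒮.step

/-- The localization `A_𝒮` of `A` at `𝒮`, the direct limit of the rings `A_{𝒮,n}`. -/
def ring {A : RingCat.{u}} (𝒮 : FISystem A) : RingCat.{u} := colimit 𝒮.diagram

/-- The natural homomorphism `i_𝒮 : A → A_𝒮`. -/
def of {A : RingCat.{u}} (𝒮 : FISystem A) : A →+* 𝒮.ring :=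
  (colimit.ι 𝒮.diagram 0).hom

/-- The cocone on the rings `A_{𝒮,n}` given by the homomorphisms `φₙ`, where `𝒮` comes
from `φ`. -/
def descCocone {A B : RingCat.{u}} [Nontrivial B] (φ : A →+* B) : Cocone (ofHom φ).diagram where
  pt := B
  ι := NatTrans.ofSequence (F := (ofHom φ).diagram) (G := (Functor.const ℕ).obj B)
    (fun n => RingCat.ofHom (stages φ n).2) (fun n => by
      have h : (ofHom φ).diagram.map (homOfLE (Nat.le_add_right n 1)) =
        RingCat.ofHom (Loc.of {x | IsUnit ((stages φ n).2 x)}) :=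
        Functor.ofSequence_map_homOfLE_succ _ _
      rw [h]
      ext x
      exact Loc.lift_of (stages φ n).2 (fun _ hx => hx) x)

/-- The extension `A_𝒮 → B` of `φ : A → B`, where `𝒮` comes from `φ`. -/
def desc {A B : RingCat.{u}} [Nontrivial B] (φ : A →+* B) : (ofHom φ).ring →+* B :=
  (colimit.desc (ofHom φ).diagram (descCocone φ)).hom

theorem desc_ι {A B : RingCat.{u}} [Nontrivial B] (φ : A →+* B) (n : ℕ)
    (x : (stages φ n).1.ring) :
    desc φ ((colimit.ι (ofHom φ).diagram n).hom x) = (stages φ n).2 x :=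
  RingHom.congr_fun (congrArg RingCat.Hom.hom (colimit.ι_desc (descCocone φ) n)) x

theorem desc_of {A B : RingCat.{u}} [Nontrivial B] (φ : A →+* B) (a : A) :
    desc φ ((ofHom φ).of a) = φ a :=
  desc_ι φ 0 a

theorem desc_comp_of {A B : RingCat.{u}} [Nontrivial B] (φ : A →+* B) :
    (desc φ).comp (ofHom φ).of = φ :=
  RingHom.ext (desc_of φ)

theorem isLocalHom_desc {A B : RingCat.{u}} [Nontrivial B] (φ : A →+* B) :
    IsLocalHom (desc φ) := by
  constructor
  intro x hx
  have : PreservesFilteredColimitsOfSize.{0, 0} (forget RingCat.{u}) :=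
    preservesSmallestFilteredColimits_of_preservesFilteredColimits _
  obtain ⟨n, y, rfl⟩ := Concrete.colimit_exists_rep (ofHom φ).diagram x
  have hy : IsUnit ((stages φ n).2 y) := by
    have := hx
    erw [desc_ι φ n y] at this
    exact this
  have hstep := congrArg RingCat.Hom.hom
    (colimit.w (ofHom φ).diagram (homOfLE (Nat.le_add_right n 1)))
  have hm : (ofHom φ).diagram.map (homOfLE (Nat.le_add_right n 1)) =
      RingCat.ofHom (Loc.of {x | IsUnit ((stages φ n).2 x)}) :=
    Functor.ofSequence_map_homOfLE_succ _ _
  rw [hm] at hstep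
  have hu : IsUnit (Loc.of {x | IsUnit ((stages φ n).2 x)} y) := Loc.isUnit_of hy
  have := hu.map (colimit.ι (ofHom φ).diagram (n + 1)).hom
  have h2 := RingHom.congr_fun hstep y
  exact h2 ▸ this

instance nontrivial_ring {A : RingCat.{u}} (𝒮 : FISystem A) : Nontrivial 𝒮.ring := by
  obtain ⟨_, B, _, φ, rfl⟩ := 𝒮
  exact (desc φ).domain_nontrivial

/-- The pull back `φ^*(𝒮)` of a fully invertible system along `φ : A → B`. -/
def comap {A B : RingCat.{u}} (φ : A →+* B) (𝒮 : FISystem B) : FISystem A :=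
  ofHom (𝒮.of.comp φ)

/-- The natural homomorphism `φ^𝒮 : A_{φ^*(𝒮)} → B_𝒮`. -/
def comapMap {A B : RingCat.{u}} (φ : A →+* B) (𝒮 : FISystem B) :
    (comap φ 𝒮).ring →+* 𝒮.ring :=
  desc (𝒮.of.comp φ)

end FISystem
/-! ## Fractions and the topology of the full spectrum -/

/-- A fraction `(a₁, …, aₙ)` of `A`: `a₁ ∈ A`, `a₂ ∈ A_{a₁}`, `a₃ ∈ (A_{a₁})_{a₂}`, ….
(The empty tuple plays the same role as the tuple `(1)`.) -/
inductive Fraction : RingCat.{u} → Type (u + 1)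
  | nil (A : RingCat.{u}) : Fraction A
  | cons {A : RingCat.{u}} (a : A) (f : Fraction (RingCat.of (Loc A {a}))) : Fraction A

namespace Fraction

/-- The iterated localization `A_𝒶 = (…(A_{a₁})_{a₂}…)_{aₙ}`. -/
def ring : ∀ {A : RingCat.{u}}, Fraction A → RingCat.{u}
  | A, nil _ => A
  | _, cons _ f => f.ring

/-- The natural homomorphism `A → A_𝒶`. -/
def of : ∀ {A : RingCat.{u}} (𝒶 : Fraction A), A →+* 𝒶.ring
  | A, nil _ => RingHom.id A
  | _, cons a f => (of f).comp (Loc.of {a})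

theorem isUnit_of_mem_singleton {A C : Type u} [Ring A] [Ring C] {ψ : A →+* C} {a : A}
    (h : IsUnit (ψ a)) : ∀ s ∈ ({a} : Set A), IsUnit (ψ s) := by
  rintro s rfl
  exact h

/-- The fraction `(a₁, …, aₙ)` becomes invertible under `ψ : A → C`: the element `ψ(a₁)` is a
unit, the image of `a₂` under the induced map `A_{a₁} → C` is a unit, and so on. -/
def Inv : ∀ {A : RingCat.{u}} (_ : Fraction A) {C : RingCat.{u}} (_ : A →+* C), Prop
  | _, nil _, _, _ => True
  | _, cons a f, _, ψ => ∃ h : IsUnit (ψ a), f.Inv (Loc.lift ψ (isUnit_of_mem_singleton h))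

/-- The homomorphism `A_𝒶 → C` induced by a `ψ : A → C` under which `𝒶` is invertible. -/
def lift : ∀ {A : RingCat.{u}} (𝒶 : Fraction A) {C : RingCat.{u}} (ψ : A →+* C),
    𝒶.Inv ψ → (𝒶.ring →+* C)
  | _, nil _, _, ψ, _ => ψ
  | _, cons _ f, _, _, h => f.lift (Loc.lift _ (isUnit_of_mem_singleton h.1)) h.2

theorem lift_of : ∀ {A : RingCat.{u}} (𝒶 : Fraction A) {C : RingCat.{u}} (ψ : A →+* C)
    (h : 𝒶.Inv ψ) (x : A), 𝒶.lift ψ h (𝒶.of x) = ψ x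
  | _, nil _, _, _, _, _ => rfl
  | _, cons _ f, _, ψ, h, x =>
    (lift_of f _ h.2 _).trans (Loc.lift_of ψ (isUnit_of_mem_singleton h.1) x)

/-- The homomorphism `A_a → B_{φ(a)}` induced by `φ : A → B`. -/
def locMap {A B : RingCat.{u}} (φ : A →+* B) (a : A) :
    (RingCat.of (Loc A {a})) →+* (RingCat.of (Loc B {φ a})) :=
  Loc.lift ((Loc.of {φ a}).comp φ)
    (isUnit_of_mem_singleton (Loc.isUnit_of (Set.mem_singleton (φ a))))

/-- The fraction `φ(𝒶)` of `B` obtained from a fraction `𝒶` of `A` along `φ : A → B`. -/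
def map : ∀ {A B : RingCat.{u}} (_ : A →+* B), Fraction A → Fraction B
  | _, B, _, nil _ => nil B
  | _, _, φ, cons a f => cons (φ a) (f.map (locMap φ a))

/-- The homomorphism `A_𝒶 → B_{φ(𝒶)}`. -/
def mapRing : ∀ {A B : RingCat.{u}} (φ : A →+* B) (𝒶 : Fraction A), 𝒶.ring →+* (𝒶.map φ).ring
  | _, _, φ, nil _ => φ
  | _, _, φ, cons a f => f.mapRing (locMap φ a)

theorem inv_congr {A : RingCat.{u}} (𝒶 : Fraction A) {C : RingCat.{u}} {ψ ψ' : A →+* C}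
    (h : ψ = ψ') : 𝒶.Inv ψ ↔ 𝒶.Inv ψ' := by
  rw [h]

theorem lift_congr {A : RingCat.{u}} (𝒶 : Fraction A) {C : RingCat.{u}} {ψ ψ' : A →+* C}
    (h : ψ = ψ') (h1 : 𝒶.Inv ψ) (h2 : 𝒶.Inv ψ') (x : 𝒶.ring) : 𝒶.lift ψ h1 x = 𝒶.lift ψ' h2 x := by
  subst h
  rfl

theorem lift_comp_lift_of {A B C : RingCat.{u}} (φ : A →+* B) (ψ : B →+* C) (a : A)
    (h : IsUnit (ψ (φ a))) :
    (Loc.lift ψ (isUnit_of_mem_singleton h)).comp (locMap φ a) =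
    Loc.lift (S := {a}) (ψ.comp φ) (isUnit_of_mem_singleton h) := by
  refine Loc.hom_ext (RingHom.ext fun x => ?_)
  simp [locMap]

theorem map_inv : ∀ {A B : RingCat.{u}} (φ : A →+* B) (𝒶 : Fraction A) {C : RingCat.{u}}
    (ψ : B →+* C), (𝒶.map φ).Inv ψ ↔ 𝒶.Inv (ψ.comp φ)
  | _, _, _, nil _, _, _ => Iff.rfl
  | _, B, φ, cons a f, C, ψ => by
    refine exists_congr fun h => ?_
    refine (f.map_inv (locMap φ a) _).trans ?_
    exact inv_congr f (lift_comp_lift_of φ ψ a h)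

theorem lift_mapRing : ∀ {A B : RingCat.{u}} (φ : A →+* B) (𝒶 : Fraction A) {C : RingCat.{u}}
    (ψ : B →+* C) (h : (𝒶.map φ).Inv ψ) (h' : 𝒶.Inv (ψ.comp φ)) (x : 𝒶.ring),
    (𝒶.map φ).lift ψ h (𝒶.mapRing φ x) = 𝒶.lift (ψ.comp φ) h' x
  | _, _, _, nil _, _, _, _, _, _ => rfl
  | _, B, φ, cons a f, C, ψ, h, h', x => by
    have e := lift_comp_lift_of φ ψ a h.1
    refine (lift_mapRing (locMap φ a) f _ h.2 ((inv_congr f e).2 h'.2)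
      x).trans ?_
    exact lift_congr f e _ _ x

theorem inv_comp : ∀ {A : RingCat.{u}} (𝒶 : Fraction A) {C D : RingCat.{u}} (ψ : A →+* C)
    (θ : C →+* D), 𝒶.Inv ψ → 𝒶.Inv (θ.comp ψ)
  | _, nil _, _, _, _, _, _ => trivial
  | _, cons a f, C, D, ψ, θ, h => by
    refine ⟨h.1.map θ, ?_⟩
    refine (inv_congr f (?_ : _ = θ.comp (Loc.lift ψ (isUnit_of_mem_singleton h.1)))).2
      (f.inv_comp _ _ h.2)
    refine Loc.hom_ext (RingHom.ext fun x => ?_)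
    simp

theorem inv_of_comp : ∀ {A : RingCat.{u}} (𝒶 : Fraction A) {C D : RingCat.{u}} (ψ : A →+* C)
    (θ : C →+* D) (_ : IsLocalHom θ), 𝒶.Inv (θ.comp ψ) → 𝒶.Inv ψ
  | _, nil _, _, _, _, _, _, _ => trivial
  | _, cons a f, C, D, ψ, θ, hθ, h => by
    have h1 : IsUnit (ψ a) := isUnit_of_map_unit θ _ h.1
    refine ⟨h1, f.inv_of_comp _ θ hθ ((inv_congr f ?_).1 h.2)⟩
    refine Loc.hom_ext (RingHom.ext fun x => ?_)
    simp

theorem lift_comp : ∀ {A : RingCat.{u}} (𝒶 : Fraction A) {C D : RingCat.{u}} (ψ : A →+* C)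
    (θ : C →+* D) (h : 𝒶.Inv ψ) (h' : 𝒶.Inv (θ.comp ψ)) (x : 𝒶.ring),
    𝒶.lift (θ.comp ψ) h' x = θ (𝒶.lift ψ h x)
  | _, nil _, _, _, _, _, _, _, _ => rfl
  | _, cons a f, C, D, ψ, θ, h, h', x => by
    have e : Loc.lift (θ.comp ψ) (isUnit_of_mem_singleton h'.1) =
        θ.comp (Loc.lift ψ (isUnit_of_mem_singleton h.1)) := by
      refine Loc.hom_ext (RingHom.ext fun x => ?_)
      simp
    refine (lift_congr f e h'.2 ((inv_congr f e).1 h'.2) x).trans ?_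
    exact f.lift_comp _ θ h.2 _ x

/-- Any two fractions `𝒶`, `𝒷` have a common refinement `𝒸`. -/
theorem exists_common : ∀ {A : RingCat.{u}} (𝒶 𝒷 : Fraction A),
    ∃ (𝒸 : Fraction A) (α : 𝒶.ring →+* 𝒸.ring) (β : 𝒷.ring →+* 𝒸.ring),
      ∀ {C : RingCat.{u}} (ψ : A →+* C) (ha : 𝒶.Inv ψ) (hb : 𝒷.Inv ψ),
        ∃ hc : 𝒸.Inv ψ, (∀ x, 𝒸.lift ψ hc (α x) = 𝒶.lift ψ ha x) ∧
          ∀ y, 𝒸.lift ψ hc (β y) = 𝒷.lift ψ hb y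
  | A, nil _, 𝒷 => ⟨𝒷, 𝒷.of, RingHom.id _, fun ψ _ hb =>
      ⟨hb, fun x => 𝒷.lift_of ψ hb x, fun _ => rfl⟩⟩
  | A, cons a f, 𝒷 => by
    obtain ⟨𝒸, α, β, h⟩ := f.exists_common (𝒷.map (B := RingCat.of (Loc A {a})) (Loc.of {a}))
    refine ⟨cons a 𝒸, α, β.comp (𝒷.mapRing _), fun ψ ha hb => ?_⟩
    have e := Loc.lift_comp_of ψ (isUnit_of_mem_singleton ha.1)
    have hb' := (inv_congr 𝒷 e).2 hb
    obtain ⟨hc, h1, h2⟩ := h (Loc.lift ψ (isUnit_of_mem_singleton ha.1)) ha.2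
      ((map_inv (B := RingCat.of (Loc A {a})) _ 𝒷 _).2 hb')
    refine ⟨⟨ha.1, hc⟩, h1, fun y => (h2 _).trans ?_⟩
    refine (lift_mapRing (B := RingCat.of (Loc A {a})) _ 𝒷 _ _ hb' y).trans ?_
    exact lift_congr 𝒷 e _ _ y

/-- The set `D(𝒶)` of all fully invertible systems `𝒮` with `𝒶 ∈ 𝒮`, i.e. such that the terms of
`𝒶` are units in `A_𝒮`. -/
def D {A : RingCat.{u}} (𝒶 : Fraction A) : Set (FISystem A) := {𝒮 | 𝒶.Inv 𝒮.of}

end Fraction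

/-- The topology of the full spectrum: it is generated by the sets `D(𝒶)`. -/
instance instTopologicalSpaceFISystem (A : RingCat.{u}) : TopologicalSpace (FISystem A) :=
  generateFrom (Set.range Fraction.D)

namespace FISystem

theorem comap_mem_D {A B : RingCat.{u}} (φ : A →+* B) (𝒶 : Fraction A) (𝒮 : FISystem B) :
    comap φ 𝒮 ∈ 𝒶.D ↔ 𝒮 ∈ (𝒶.map φ).D := by
  change 𝒶.Inv (comap φ 𝒮).of ↔ (𝒶.map φ).Inv 𝒮.of
  rw [Fraction.map_inv]
  have e : (comapMap φ 𝒮).comp (comap φ 𝒮).of = 𝒮.of.comp φ := desc_comp_of _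
  rw [← Fraction.inv_congr 𝒶 e]
  exact ⟨fun h => 𝒶.inv_comp _ _ h, fun h => 𝒶.inv_of_comp _ _ (isLocalHom_desc _) h⟩

theorem continuous_comap {A B : RingCat.{u}} (φ : A →+* B) : Continuous (comap φ) := by
  refine continuous_generateFrom_iff.2 ?_
  rintro _ ⟨𝒶, rfl⟩
  have : comap φ ⁻¹' 𝒶.D = (𝒶.map φ).D := Set.ext fun 𝒮 => comap_mem_D φ 𝒶 𝒮
  rw [this]
  exact isOpen_generateFrom_of_mem ⟨_, rfl⟩

end FISystem

/-! ## The structure sheaf of the full spectrum -/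

/-- The full spectrum of `A` as a topological space. -/
abbrev FTop (A : RingCat.{u}) : TopCat.{u} := TopCat.of (FISystem A)

/-- A function `t` on `U` with `t(𝒮) ∈ A_𝒮` is presented by an element `b ∈ A_𝒶`, where `𝒶` is a
fraction with `U ⊆ D(𝒶)`, if `t(𝒮)` is the image of `b` in `A_𝒮` for all `𝒮 ∈ U`. -/
def isPresentedPrelocal (A : RingCat.{u}) :
    TopCat.PrelocalPredicate (X := FTop A) fun 𝒮 => (FISystem.ring 𝒮 : Type u) where
  pred {U} t := ∃ (𝒶 : Fraction A) (b : 𝒶.ring), ∀ 𝒮 : U,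
    ∃ h : 𝒶.Inv (FISystem.of 𝒮.1), t 𝒮 = 𝒶.lift _ h b
  res := by
    rintro U V i t ⟨𝒶, b, h⟩
    exact ⟨𝒶, b, fun 𝒮 => h ⟨𝒮.1, i.le 𝒮.2⟩⟩

/-- The functions which are locally presented by elements of the rings `A_𝒶`. -/
def isLocallyPresented (A : RingCat.{u}) :
    TopCat.LocalPredicate (X := FTop A) fun 𝒮 => (FISystem.ring 𝒮 : Type u) :=
  (isPresentedPrelocal A).sheafify

/-- The ring of sections of the structure sheaf over an open subset `U` of the full spectrum. -/
def sections (A : RingCat.{u}) (U : Opens (FTop A)) :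
    Subring (∀ 𝒮 : U, (FISystem.ring 𝒮.1 : Type u)) where
  carrier := {t | (isLocallyPresented A).pred t}
  zero_mem' := fun x => ⟨U, x.2, 𝟙 _, Fraction.nil A, (0 : A), fun 𝒮 =>
    ⟨trivial, (map_zero (FISystem.of 𝒮.1)).symm⟩⟩
  one_mem' := fun x => ⟨U, x.2, 𝟙 _, Fraction.nil A, (1 : A), fun 𝒮 =>
    ⟨trivial, (map_one (FISystem.of 𝒮.1)).symm⟩⟩
  neg_mem' := by
    intro s hs x
    obtain ⟨V, hx, i, 𝒶, b, h⟩ := hs x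
    refine ⟨V, hx, i, 𝒶, -b, fun 𝒮 => ⟨(h 𝒮).1, ?_⟩⟩
    rw [map_neg, ← (h 𝒮).2]
    rfl
  add_mem' := by
    intro s t hs ht x
    obtain ⟨V, hx, i, 𝒶, b, h⟩ := hs x
    obtain ⟨V', hx', i', 𝒶', b', h'⟩ := ht x
    obtain ⟨𝒸, α, β, hc⟩ := 𝒶.exists_common 𝒶'
    refine ⟨V ⊓ V', ⟨hx, hx'⟩, Opens.infLELeft _ _ ≫ i, 𝒸, α b + β b', fun 𝒮 => ?_⟩
    obtain ⟨h1, e1⟩ := h ⟨𝒮.1, 𝒮.2.1⟩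
    obtain ⟨h2, e2⟩ := h' ⟨𝒮.1, 𝒮.2.2⟩
    obtain ⟨h3, e3, e4⟩ := hc _ h1 h2
    refine ⟨h3, ?_⟩
    rw [map_add, e3, e4, ← e1, ← e2]
    rfl
  mul_mem' := by
    intro s t hs ht x
    obtain ⟨V, hx, i, 𝒶, b, h⟩ := hs x
    obtain ⟨V', hx', i', 𝒶', b', h'⟩ := ht x
    obtain ⟨𝒸, α, β, hc⟩ := 𝒶.exists_common 𝒶'
    refine ⟨V ⊓ V', ⟨hx, hx'⟩, Opens.infLELeft _ _ ≫ i, 𝒸, α b * β b', fun 𝒮 => ?_⟩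
    obtain ⟨h1, e1⟩ := h ⟨𝒮.1, 𝒮.2.1⟩
    obtain ⟨h2, e2⟩ := h' ⟨𝒮.1, 𝒮.2.2⟩
    obtain ⟨h3, e3, e4⟩ := hc _ h1 h2
    refine ⟨h3, ?_⟩
    rw [map_mul, e3, e4, ← e1, ← e2]
    rfl

/-- Restriction of sections. -/
def sectionsRes (A : RingCat.{u}) {U V : Opens (FTop A)} (i : U ⟶ V) :
    sections A V →+* sections A U where
  toFun t := ⟨fun x => t.1 ⟨x.1, i.le x.2⟩, (isLocallyPresented A).res i t.1 t.2⟩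
  map_one' := rfl
  map_zero' := rfl
  map_mul' _ _ := rfl
  map_add' _ _ := rfl

/-- The structure sheaf of the full spectrum, as a presheaf of rings. -/
def structurePresheaf (A : RingCat.{u}) : TopCat.Presheaf RingCat.{u} (FTop A) where
  obj U := RingCat.of (sections A U.unop)
  map i := RingCat.ofHom (sectionsRes A i.unop)
  map_id _ := rfl
  map_comp _ _ := rfl

theorem structurePresheaf_isSheaf (A : RingCat.{u}) : (structurePresheaf A).IsSheaf := by
  refine (TopCat.Presheaf.isSheaf_iff_isSheaf_comp (forget RingCat.{u}) _).2 ?_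
  refine TopCat.Presheaf.isSheaf_of_iso
    (F := TopCat.subpresheafToTypes (isLocallyPresented A).toPrelocalPredicate) ?_
    (TopCat.subpresheafToTypes.isSheaf (isLocallyPresented A))
  exact NatIso.ofComponents (fun U => Iso.refl _) (fun i => rfl)

/-! ## Ringed spaces and local morphisms -/

/-- Ringed spaces: topological spaces with a sheaf of (possibly noncommutative) rings. -/
abbrev RSpace : Type (u + 1) := SheafedSpace RingCat.{u}

/-- A morphism of ringed spaces is local if all the homomorphisms `O_{Y,f(x)} → O_{X,x}` are
local, i.e. reflect units. -/
def IsLocalMor {X Y : RSpace.{u}} (f : X ⟶ Y) : Prop :=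
  ∀ x : X, IsLocalHom (f.hom.stalkMap x).hom

theorem isLocalMor_id (X : RSpace.{u}) : IsLocalMor (𝟙 X) := by
  intro x
  have h : (𝟙 X : X ⟶ X).hom.stalkMap x = 𝟙 _ := PresheafedSpace.stalkMap.id X.toPresheafedSpace x
  rw [h]
  exact ⟨fun _ ha => ha⟩

theorem isLocalMor_comp {X Y Z : RSpace.{u}} {f : X ⟶ Y} {g : Y ⟶ Z} (hf : IsLocalMor f)
    (hg : IsLocalMor g) : IsLocalMor (f ≫ g) := by
  intro x
  have h : (f ≫ g).hom.stalkMap x = g.hom.stalkMap (f.hom.base x) ≫ f.hom.stalkMap x :=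
    PresheafedSpace.stalkMap.comp f.hom g.hom x
  rw [h]
  exact ⟨fun a ha => (hg (f.hom.base x)).map_nonunit a ((hf x).map_nonunit _ ha)⟩

/-- The full spectrum `F(A)` of a ring `A` as a ringed space. -/
def F (A : RingCat.{u}) : RSpace.{u} where
  carrier := FTop A
  presheaf := structurePresheaf A
  IsSheaf := structurePresheaf_isSheaf A

/-- The action of `φ : A → B` on sections: a section `t` is sent to
`𝒮 ↦ φ^𝒮 (t (φ^*(𝒮)))`. -/
def comapSections {A B : RingCat.{u}} (φ : A →+* B) (U : Opens (FTop A)) (V : Opens (FTop B))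
    (h : ∀ 𝒮 ∈ V, FISystem.comap φ 𝒮 ∈ U) : sections A U →+* sections B V where
  toFun t := ⟨fun 𝒮 => FISystem.comapMap φ 𝒮.1 (t.1 ⟨FISystem.comap φ 𝒮.1, h 𝒮.1 𝒮.2⟩), by
    intro 𝒮
    obtain ⟨W, hx, i, 𝒶, b, hb⟩ := t.2 ⟨FISystem.comap φ 𝒮.1, h 𝒮.1 𝒮.2⟩
    refine ⟨V ⊓ ⟨FISystem.comap φ ⁻¹' W, W.2.preimage (FISystem.continuous_comap φ)⟩,
      ⟨𝒮.2, hx⟩, Opens.infLELeft _ _, 𝒶.map φ, 𝒶.mapRing φ b, fun 𝒯 => ?_⟩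
    obtain ⟨h1, e1⟩ := hb ⟨FISystem.comap φ 𝒯.1, 𝒯.2.2⟩
    have h2 : 𝒯.1 ∈ (𝒶.map φ).D := (FISystem.comap_mem_D φ 𝒶 𝒯.1).1 h1
    refine ⟨h2, ?_⟩
    have h3 : 𝒶.Inv ((FISystem.of 𝒯.1).comp φ) := (𝒶.map_inv φ _).1 h2
    have e : (FISystem.comapMap φ 𝒯.1).comp (FISystem.comap φ 𝒯.1).of = (FISystem.of 𝒯.1).comp φ :=
      FISystem.desc_comp_of _
    rw [𝒶.lift_mapRing φ _ h2 h3 b]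
    have h4 := (𝒶.inv_congr e).2 h3
    rw [← 𝒶.lift_congr e h4 h3 b, 𝒶.lift_comp _ _ h1 h4 b]
    exact congrArg (FISystem.comapMap φ 𝒯.1) e1⟩
  map_one' := Subtype.ext (funext fun _ => map_one _)
  map_zero' := Subtype.ext (funext fun _ => map_zero _)
  map_mul' _ _ := Subtype.ext (funext fun _ => map_mul _ _ _)
  map_add' _ _ := Subtype.ext (funext fun _ => map_add _ _ _)

/-- The morphism `F(B) → F(A)` induced by a ring homomorphism `φ : A → B`. -/
def F.map {A B : RingCat.{u}} (φ : A ⟶ B) : F B ⟶ F A :=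
  InducedCategory.homMk
    { base := TopCat.ofHom ⟨FISystem.comap φ.hom, FISystem.continuous_comap φ.hom⟩
      c :=
        { app := fun U => RingCat.ofHom (comapSections φ.hom U.unop _ fun _ h => h)
          naturality := fun _ _ _ => rfl } }

/-! ## Local points -/

/-- The set of local points of a ringed space, with the subspace topology. -/
def localPoints (X : RSpace.{u}) : TopCat.{u} :=
  TopCat.of {x : X // IsLocalRing (X.presheaf.stalk x)}

/-- The inclusion of the set of local points. -/
def localPointsIncl (X : RSpace.{u}) : localPoints X ⟶ (X : TopCat.{u}) :=
  TopCat.ofHom ⟨Subtype.val, continuous_subtype_val⟩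

/-- The ringed subspace `L(X)` of local points of `X`: its structure sheaf is the restriction
(inverse image) of the structure sheaf of `X`. -/
def L (X : RSpace.{u}) : RSpace.{u} where
  carrier := localPoints X
  presheaf := ((TopCat.Sheaf.pullback RingCat.{u} (localPointsIncl X)).obj X.sheaf).obj
  IsSheaf := ((TopCat.Sheaf.pullback RingCat.{u} (localPointsIncl X)).obj X.sheaf).property

/-- The inclusion morphism `L(X) → X`. -/
def L.incl (X : RSpace.{u}) : L X ⟶ X :=
  InducedCategory.homMk
    { base := localPointsIncl X
      c := ((TopCat.Sheaf.pullbackPushforwardAdjunction RingCat.{u}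
        (localPointsIncl X)).unit.app X.sheaf).hom }

/-! ## F-schemes -/

/-- An F-scheme is a ringed space which is locally isomorphic to full spectra of rings. -/
def IsFScheme (X : RSpace.{u}) : Prop :=
  ∀ x : X, ∃ (U : Opens X) (_ : x ∈ U) (A : RingCat.{u}),
    Nonempty (X.restrict U.isOpenEmbedding ≅ F A)

/-- `X` has an open covering by full spectra of commutative rings. -/
def HasCommCover (X : RSpace.{u}) : Prop :=
  ∀ x : X, ∃ (U : Opens X) (_ : x ∈ U) (A : CommRingCat.{u}),
    Nonempty (X.restrict U.isOpenEmbedding ≅ F ((forget₂ CommRingCat.{u} RingCat.{u}).obj A))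

/-- Commutative F-schemes. -/
structure CFSch : Type (u + 1) where
  toRSpace : RSpace.{u}
  isFScheme : IsFScheme toRSpace
  hasCommCover : HasCommCover toRSpace

/-- The morphisms of F-schemes are the local morphisms of ringed spaces. -/
@[ext]
structure CFSch.Hom (X Y : CFSch.{u}) where
  toHom : X.toRSpace ⟶ Y.toRSpace
  isLocal : IsLocalMor toHom

instance instCategoryCFSch : Category CFSch.{u} where
  Hom X Y := CFSch.Hom X Y
  id X := ⟨𝟙 _, isLocalMor_id _⟩
  comp f g := ⟨f.toHom ≫ g.toHom, isLocalMor_comp f.isLocal g.isLocal⟩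

/-! ## Schemes as ringed spaces -/

/-- The ringed space underlying a scheme. -/
def ofScheme (X : Scheme.{u}) : RSpace.{u} where
  toPresheafedSpace := (forget₂ CommRingCat.{u} RingCat.{u}).mapPresheaf.obj X.toPresheafedSpace
  IsSheaf := by
    refine (TopCat.Presheaf.isSheaf_iff_isSheaf_comp (forget RingCat.{u}) _).2 ?_
    exact (TopCat.Presheaf.isSheaf_iff_isSheaf_comp (forget CommRingCat.{u}) X.presheaf).1 X.IsSheaf

/-- The morphism of ringed spaces underlying a morphism of schemes. -/
def ofSchemeMap {X Y : Scheme.{u}} (f : X ⟶ Y) : ofScheme X ⟶ ofScheme Y :=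
  InducedCategory.homMk ((forget₂ CommRingCat.{u} RingCat.{u}).mapPresheaf.map f.toPshHom)

end FSch
end

noncomputable section

namespace FSch

/-! ## Homomorphisms out of the localization at a fully invertible system -/

/-! The system attached to `φ : A → B` records only which elements become units, stage by stage, so
it does not change when `φ` is followed by a local homomorphism (`stages_comp`, `ofHom_comp`). Since
`desc φ : A_𝒮 → B` is local, `𝒮` is also the system of `i_𝒮`. Moreover `i_𝒮` is an epimorphism
(`FISystem.hom_ext`).

Let `A` be commutative. Centralizers are closed under inverses, so `A_𝒮` is commutative
(`FISystem.mul_comm`). If `M` denotes the elements of `A` which become units in `A_𝒮`, then `M⁻¹A →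
A_𝒮` is local: when `a/s` becomes a unit, so does `a`, hence `a ∈ M`. Therefore `𝒮` is the system of
`A → M⁻¹A` (`ofHom_algebraMap`), and elements of `A_𝒮` can be handled as ordinary fractions over
`M`. If `A_𝒮` is local, `M` is the complement of a prime `P`, and `𝒮` is the system of `A → A_P`.

Iterated fractions also collapse: by `Fraction.exists_eq_div`, inverting `𝒶` amounts to inverting a
single `d ∈ A`, and an element of `A_𝒶` acts as some `x/d`. So `D(𝒶)` meets the prime systems in a
basic open set, and the stalk of `F(A)` at `𝒮` is `A_𝒮` (`evalStalk_bijective`). Thus `Spec(A) →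
F(A)` is an embedding onto the local points which is bijective on stalks. Passing to the inverse
image sheaf preserves stalks (`isIso_stalkHom_pullback_unit`), so the induced map to `L(F(A))` is an
isomorphism.

For a commutative F-scheme `X`, each open chart `F(A) → X` yields an open chart `Spec(A) → L(X)`
(`CFSch.exists_spec_chart`), so `L(X)` is a scheme. A ring with a local homomorphism to a local ring
is itself local; hence local morphisms preserve local points. Functoriality follows because `L(X) →
X` is a monomorphism. -/

theorem FISystem.segMap_hom_ext {A C : RingCat.{u}} {n : ℕ} {t : Seg A (n + 1)} {t' : Seg A n}
    (h : Seg.init t = t') {f g : t.ring ⟶ C} (hfg : segMap t t' h ≫ f = segMap t t' h ≫ g) :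
    f = g := by
  subst h
  exact RingCat.hom_ext (Loc.hom_ext (congrArg RingCat.Hom.hom hfg))

/-- Each step of the tower is a universal localization, hence an epimorphism, so agreement on `A`
propagates by induction to every stage and then to the colimit. -/
theorem FISystem.hom_ext {A : RingCat.{u}} {𝒮 : FISystem A} {C : Type u} [Ring C]
    {f g : 𝒮.ring →+* C} (h : f.comp 𝒮.of = g.comp 𝒮.of) : f = g := by
  have key : (RingCat.ofHom f : 𝒮.ring ⟶ RingCat.of C) = RingCat.ofHom g := by
    refine colimit.hom_ext fun n => ?_
    induction n with
    | zero => exact RingCat.hom_ext h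
    | succ n ih =>
      have hm : 𝒮.diagram.map (homOfLE (Nat.le_add_right n 1)) = 𝒮.step n :=
        Functor.ofSequence_map_homOfLE_succ _ _
      rw [← colimit.w 𝒮.diagram (homOfLE (Nat.le_add_right n 1)), hm] at ih
      exact segMap_hom_ext _ ((Category.assoc _ _ _).symm.trans (ih.trans (Category.assoc _ _ _)))
  exact congrArg RingCat.Hom.hom key

/-- Packaging the segment and the homomorphism in one dependent pair lets the inductive step of
`stages_comp` replace `S` by `S'` without transporting maps between localizations. -/
theorem Loc.sigma_lift_comp {A B C : RingCat.{u}} {n : ℕ} (t : Seg A n) (χ : t.ring →+* B)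
    (θ : B →+* C) (S S' : Set t.ring) (hS : S = S') (h : ∀ s ∈ S, IsUnit (θ.comp χ s))
    (h' : ∀ s ∈ S', IsUnit (χ s)) :
    (⟨⟨t, S⟩, Loc.lift (θ.comp χ) h⟩ : Σ t : Seg A (n + 1), (t.ring →+* C)) =
      ⟨⟨t, S'⟩, θ.comp (Loc.lift χ h')⟩ := by
  subst hS
  have : Loc.lift (θ.comp χ) h = θ.comp (Loc.lift χ h') :=
    Loc.hom_ext (RingHom.ext fun x => by simp)
  exact congrArg (fun g => (⟨⟨t, S⟩, g⟩ : Σ t : Seg A (n + 1), (t.ring →+* C))) this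

/-- A local `θ` both preserves and reflects units, so at each stage the same elements get inverted.
-/
theorem stages_comp {A B C : RingCat.{u}} (ψ : A →+* B) (θ : B →+* C) (hθ : IsLocalHom θ)
    (n : ℕ) : stages (θ.comp ψ) n = ⟨(stages ψ n).1, θ.comp (stages ψ n).2⟩ := by
  induction n with
  | zero => rfl
  | succ n ih =>
    change (⟨⟨(stages (θ.comp ψ) n).1, {x | IsUnit ((stages (θ.comp ψ) n).2 x)}⟩,
      Loc.lift (stages (θ.comp ψ) n).2 fun _ hx => hx⟩ :
        Σ t : Seg A (n + 1), (t.ring →+* C)) = _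
    rw [ih]
    exact Loc.sigma_lift_comp _ _ θ _ _
      (Set.ext fun x => ⟨fun hx => isUnit_of_map_unit θ _ hx, fun hx => IsUnit.map θ hx⟩) _ _

namespace FISystem

theorem ofHom_comp {A B C : RingCat.{u}} [Nontrivial B] [Nontrivial C] (ψ : A →+* B)
    (θ : B →+* C) (hθ : IsLocalHom θ) : ofHom (θ.comp ψ) = ofHom ψ := by
  ext1
  funext n
  exact congrArg Sigma.fst (stages_comp ψ θ hθ n)

/-- If `𝒮` comes from `φ`, then `φ` factors as `i_𝒮` followed by the local map `desc φ`, so both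
define the same system. -/
theorem ofHom_of {A : RingCat.{u}} (𝒮 : FISystem A) : ofHom 𝒮.of = 𝒮 := by
  obtain ⟨_, B, hB, φ, rfl⟩ := 𝒮
  change ofHom (ofHom φ).of = ofHom φ
  rw [← ofHom_comp _ (desc φ) (isLocalHom_desc φ), desc_comp_of]

theorem exists_desc {A C : RingCat.{u}} [Nontrivial C] (𝒮 : FISystem A) (φ : A →+* C)
    (h : ofHom φ = 𝒮) : ∃ θ : 𝒮.ring →+* C, θ.comp 𝒮.of = φ ∧ IsLocalHom θ := by
  subst h
  exact ⟨desc φ, desc_comp_of φ, isLocalHom_desc φ⟩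

/-- Ring homomorphisms out of the localizations at equal systems are compatible as soon as they
agree on `A`. -/
theorem hom_congr {A : RingCat.{u}} {C : Type u} [Ring C] {X : Type*} {ι : X → FISystem A}
    (t : ∀ x, (ι x).ring) {x y : X} (hxy : x = y) (α : (ι x).ring →+* C) (β : (ι y).ring →+* C)
    (h : α.comp (ι x).of = β.comp (ι y).of) : α (t x) = β (t y) := by
  subst hxy
  rw [hom_ext h]

/-! ## Commutativity -/

/-- Closure of `T` under inverses says exactly that the inclusion of `T` is local. So `A → T` also
defines `𝒮` and extends to `A_𝒮 → T`; followed by the inclusion this is the identity, since `i_𝒮` is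
an epimorphism. -/
theorem subring_eq_top {A : RingCat.{u}} (𝒮 : FISystem A) (T : Subring 𝒮.ring)
    (hA : ∀ a, 𝒮.of a ∈ T) (hT : ∀ u : 𝒮.ringˣ, (u : 𝒮.ring) ∈ T → ((u⁻¹ : 𝒮.ringˣ) : 𝒮.ring) ∈ T)
    (x : 𝒮.ring) : x ∈ T := by
  let T' : RingCat.{u} := RingCat.of T
  have : Nontrivial T' := inferInstanceAs (Nontrivial T)
  let φ : A →+* T' := RingHom.codRestrict 𝒮.of T hA
  let ι : T' →+* 𝒮.ring := T.subtype
  have hι : IsLocalHom ι := ⟨fun y ⟨w, hw⟩ =>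
    ⟨⟨y, ⟨((w⁻¹ : 𝒮.ringˣ) : 𝒮.ring), hT w (hw ▸ y.2)⟩,
      Subtype.ext ((congrArg (· * _) hw.symm).trans w.mul_inv),
      Subtype.ext ((congrArg (_ * ·) hw.symm).trans w.inv_mul)⟩, rfl⟩⟩
  have e : ofHom φ = 𝒮 := by
    rw [← ofHom_comp φ ι hι, show ι.comp φ = 𝒮.of from rfl, ofHom_of]
  obtain ⟨θ, hθ, -⟩ := exists_desc 𝒮 φ e
  have : (ι.comp θ) = RingHom.id _ := hom_ext (by rw [RingHom.comp_assoc, hθ]; rfl)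
  have h := (θ x).2
  rwa [show ((θ x : T') : T).1 = x from RingHom.congr_fun this x] at h

end FISystem

theorem Loc.subring_eq_top {A : Type u} [Ring A] {S : Set A} (T : Subring (Loc A S))
    (hA : ∀ a, Loc.of S a ∈ T)
    (hT : ∀ u : (Loc A S)ˣ, (∃ s ∈ S, (u : Loc A S) = Loc.of S s) → ((u⁻¹ : (Loc A S)ˣ) : Loc A S) ∈ T)
    (x : Loc A S) : x ∈ T := by
  let φ : A →+* T := RingHom.codRestrict (Loc.of S) T hA
  have h : ∀ s ∈ S, IsUnit (φ s) := fun s hs => by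
    obtain ⟨w, hw⟩ := Loc.isUnit_of hs
    exact ⟨⟨φ s, ⟨_, hT w ⟨s, hs, hw⟩⟩,
      Subtype.ext ((congrArg (· * _) hw.symm).trans w.mul_inv),
      Subtype.ext ((congrArg (_ * ·) hw.symm).trans w.inv_mul)⟩, rfl⟩
  have : (T.subtype.comp (Loc.lift φ h)) = RingHom.id _ :=
    Loc.hom_ext (RingHom.ext fun a => by simp [φ])
  have h' := (Loc.lift φ h x).2
  rwa [show (Loc.lift φ h x).1 = x from RingHom.congr_fun this x] at h'

/-- Centralizers are closed under inverses, so the principle applies twice: the centralizer of the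
image of `A` is everything, hence the image is central, hence the centre is everything. -/
theorem mul_comm_of_subring_eq_top {A B : Type u} [Ring A] [Ring B] (φ : A →+* B)
    (hA : ∀ x y : A, x * y = y * x)
    (h : ∀ T : Subring B, (∀ a, φ a ∈ T) →
      (∀ u : Bˣ, (u : B) ∈ T → ((u⁻¹ : Bˣ) : B) ∈ T) → ∀ x, x ∈ T) (x y : B) :
    x * y = y * x := by
  have hinv (X : Set B) (u : Bˣ) (hu : (u : B) ∈ Subring.centralizer X) :
      ((u⁻¹ : Bˣ) : B) ∈ Subring.centralizer X := by
    rw [Subring.mem_centralizer_iff] at hu ⊢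
    exact fun g hg => (Commute.units_inv_right (hu g hg : Commute g u))
  have h1 := h (Subring.centralizer (Set.range φ)) (fun a => by
    rw [Subring.mem_centralizer_iff]
    rintro _ ⟨b, rfl⟩
    rw [← map_mul, hA, map_mul]) (hinv _)
  have h2 := h (Subring.centralizer Set.univ) (fun a => by
    rw [Subring.mem_centralizer_iff]
    intro b _
    exact ((Subring.mem_centralizer_iff.1 (h1 b)) _ ⟨a, rfl⟩).symm) (hinv _) y
  exact Subring.mem_centralizer_iff.1 h2 x trivial

theorem Loc.mul_comm {A : Type u} [Ring A] (hA : ∀ x y : A, x * y = y * x) (S : Set A)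
    (x y : Loc A S) : x * y = y * x :=
  mul_comm_of_subring_eq_top (Loc.of S) hA (fun T hT hu => Loc.subring_eq_top T hT
    fun u ⟨s, _, hs⟩ => hu u (hs ▸ hT s)) x y

theorem FISystem.mul_comm {A : RingCat.{u}} (hA : ∀ x y : A, x * y = y * x) (𝒮 : FISystem A)
    (x y : 𝒮.ring) : x * y = y * x :=
  mul_comm_of_subring_eq_top 𝒮.of hA 𝒮.subring_eq_top x y

/-! ## Fractions over commutative rings -/

/-- Every element of `A_a`, for commutative `A`, is of the form `b / aⁿ`. -/
theorem Loc.exists_pow_mul_eq {A : Type u} [Ring A] (hA : ∀ x y : A, x * y = y * x) (a : A)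
    (x : Loc A {a}) : ∃ (n : ℕ) (b : A), Loc.of {a} a ^ n * x = Loc.of {a} b := by
  have hc := Loc.mul_comm hA {a}
  let T : Subring (Loc A {a}) :=
    { carrier := {x | ∃ (n : ℕ) (b : A), Loc.of {a} a ^ n * x = Loc.of {a} b}
      zero_mem' := ⟨0, 0, by simp⟩
      one_mem' := ⟨0, 1, by simp⟩
      neg_mem' := by
        rintro x ⟨n, b, h⟩
        exact ⟨n, -b, by rw [mul_neg, h, map_neg]⟩
      add_mem' := by
        rintro x y ⟨n, b, h⟩ ⟨m, c, h'⟩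
        refine ⟨m + n, a ^ m * b + a ^ n * c, ?_⟩
        rw [mul_add, pow_add, mul_assoc, h, hc (_ ^ m) (_ ^ n), mul_assoc, h', map_add, map_mul,
          map_mul, map_pow, map_pow]
      mul_mem' := by
        rintro x y ⟨n, b, h⟩ ⟨m, c, h'⟩
        refine ⟨m + n, b * c, ?_⟩
        rw [map_mul, ← h, ← h', pow_add, mul_assoc, ← mul_assoc _ x y, ← mul_assoc, ← mul_assoc,
          hc (_ ^ m) (_ ^ n), mul_assoc (_ ^ n) (_ ^ m), hc (_ ^ m) x]
        simp only [mul_assoc] }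
  refine Loc.subring_eq_top T (fun b => ⟨0, b, by simp⟩) ?_ x
  rintro u ⟨s, rfl, hu⟩
  exact ⟨1, 1, by rw [pow_one, ← hu, Units.mul_inv, map_one]⟩

/-- One denominator `d` and one numerator `x` serve all targets `C`, commutative or not: inverting
`𝒶` is the same as inverting `d`, and `b` acts as `x/d`. The induction on the length of `𝒶` clears
the powers of `a` in the denominator and numerator found over `A_a`. -/
theorem Fraction.exists_eq_div : ∀ {A : RingCat.{u}} (_ : ∀ x y : A, x * y = y * x)
    (𝒶 : Fraction A) (b : 𝒶.ring), ∃ d x : A, ∀ {C : RingCat.{u}} (ψ : A →+* C),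
      (𝒶.Inv ψ ↔ IsUnit (ψ d)) ∧ ∀ h : 𝒶.Inv ψ, ψ d * 𝒶.lift ψ h b = ψ x
  | A, hA, nil _, b => ⟨1, b, fun ψ => ⟨by simp [Inv], fun _ => by rw [map_one, one_mul]; rfl⟩⟩
  | A, hA, cons a f, b => by
    obtain ⟨d, x, H⟩ := exists_eq_div (A := RingCat.of (Loc A {a})) (Loc.mul_comm hA {a}) f b
    obtain ⟨n, d', hd⟩ := Loc.exists_pow_mul_eq hA a d
    obtain ⟨m, x', hx⟩ := Loc.exists_pow_mul_eq hA a x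
    -- With `d' = aⁿd` and `x' = aᵐx` in `A_a`, cross-multiplying gives `d · b = x` the common
    -- factor `aᵐaⁿ`. The extra factor `a` forces `a` itself to become a unit even when `m = 0`.
    refine ⟨a * (a ^ m * d'), a * (a ^ n * x'), fun {C} ψ => ?_⟩
    have hcomm (x y : A) : Commute (ψ x) (ψ y) := by
      rw [commute_iff_eq, ← map_mul, hA, map_mul]
    have key (h : IsUnit (ψ a)) :
        ψ a ^ n * Loc.lift ψ (isUnit_of_mem_singleton h) d = ψ d' ∧
        ψ a ^ m * Loc.lift ψ (isUnit_of_mem_singleton h) x = ψ x' := by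
      have h1 := congrArg (Loc.lift ψ (isUnit_of_mem_singleton h)) hd
      have h2 := congrArg (Loc.lift ψ (isUnit_of_mem_singleton h)) hx
      simp only [map_mul, map_pow, Loc.lift_of] at h1 h2
      exact ⟨h1, h2⟩
    have hunit (h : IsUnit (ψ a)) :
        IsUnit (Loc.lift ψ (isUnit_of_mem_singleton h) d) ↔ IsUnit (ψ d') := by
      rw [← (key h).1, ← (h.pow n).unit_spec, Units.isUnit_units_mul]
    refine ⟨?_, fun h => ?_⟩
    · rw [map_mul, (hcomm _ _).isUnit_mul_iff, map_mul, (hcomm _ _).isUnit_mul_iff, map_pow]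
      constructor
      · rintro ⟨h, hf⟩
        exact ⟨h, h.pow m, (hunit h).1 ((H _).1.1 hf)⟩
      · rintro ⟨h, -, h'⟩
        exact ⟨h, (H _).1.2 ((hunit h).2 h')⟩
    · have e := (H (Loc.lift ψ (isUnit_of_mem_singleton h.1))).2 h.2
      obtain ⟨k1, k2⟩ := key h.1
      change ψ _ * f.lift _ h.2 b = _
      rw [map_mul, map_mul, map_pow, map_mul, map_mul, map_pow, ← k1, ← k2, ← e,
        (((Commute.refl (ψ a)).pow_pow n m)).left_comm]
      simp only [mul_assoc]

/-! ## The localization of a commutative ring at a fully invertible system -/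

namespace FISystem

variable {A : Type u} [CommRing A]

/-- The elements of `A` which become units in `A_𝒮`. -/
def units (𝒮 : FISystem (RingCat.of A)) : Submonoid A :=
  (IsUnit.submonoid 𝒮.ring).comap (𝒮.of : A →* 𝒮.ring)

theorem mem_units {𝒮 : FISystem (RingCat.of A)} {a : A} : a ∈ 𝒮.units ↔ IsUnit (𝒮.of a) :=
  Iff.rfl

/-- The commutative ring structure on the localization of a commutative ring. -/
abbrev commRing (𝒮 : FISystem (RingCat.of A)) : CommRing 𝒮.ring :=
  { (inferInstance : Ring 𝒮.ring) with mul_comm := 𝒮.mul_comm (fun x y : A => _root_.mul_comm x y) }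

/-- The map is local because the submonoid is saturated: if `a/s` becomes a unit in `A_𝒮`, so does
`a`, whence `a` is already inverted in `C`. -/
theorem exists_localization_hom (𝒮 : FISystem (RingCat.of A)) (C : Type u) [CommRing C]
    [Algebra A C] [IsLocalization 𝒮.units C] :
    ∃ θ : C →+* 𝒮.ring, θ.comp (algebraMap A C) = 𝒮.of ∧ IsLocalHom θ := by
  let _ := 𝒮.commRing
  have hu : ∀ y : 𝒮.units, IsUnit (𝒮.of (y : A)) := fun y => y.2
  refine ⟨IsLocalization.lift (M := 𝒮.units) (g := 𝒮.of) hu, IsLocalization.lift_comp hu, ⟨?_⟩⟩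
  intro x hx
  obtain ⟨⟨a, s⟩, e⟩ := IsLocalization.surj 𝒮.units x
  have h1 := (hx.mul (hu s))
  have h2 := congrArg (IsLocalization.lift (M := 𝒮.units) (g := 𝒮.of) hu) e
  rw [map_mul, IsLocalization.lift_eq, IsLocalization.lift_eq] at h2
  have ha : a ∈ 𝒮.units := by
    rw [mem_units, ← h2]
    exact h1
  exact isUnit_of_mul_isUnit_left (e ▸ IsLocalization.map_units C ⟨a, ha⟩)

theorem ofHom_algebraMap (𝒮 : FISystem (RingCat.of A)) (C : Type u) [CommRing C]
    [Algebra A C] [IsLocalization 𝒮.units C] [Nontrivial C] :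
    haveI : Nontrivial (RingCat.of C) := ‹Nontrivial C›
    ofHom (A := RingCat.of A) (B := RingCat.of C) (algebraMap A C) = 𝒮 := by
  obtain ⟨θ, hθ, hl⟩ := 𝒮.exists_localization_hom C
  have : Nontrivial (RingCat.of C) := ‹Nontrivial C›
  have h := ofHom_comp (A := RingCat.of A) (B := RingCat.of C) (algebraMap A C) θ hl
  exact h.symm.trans ((congrArg (fun g => ofHom (A := RingCat.of A) g) hθ).trans 𝒮.ofHom_of)

/-- As `𝒮` is also the system of `A → C`, there is a map `δ : A_𝒮 → C`; since `i_𝒮` is an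
epimorphism, `θ ∘ δ` is the identity. A fraction representing `δ y` is therefore carried by `θ` to
one representing `y`. -/
theorem exists_of_mul_eq (𝒮 : FISystem (RingCat.of A)) (y : 𝒮.ring) :
    ∃ s ∈ 𝒮.units, ∃ a : A, 𝒮.of s * y = 𝒮.of a := by
  let C := Localization 𝒮.units
  obtain ⟨θ, hθ, hl⟩ := 𝒮.exists_localization_hom C
  have hC : Nontrivial C := θ.domain_nontrivial
  have : Nontrivial (RingCat.of C) := hC
  obtain ⟨δ, hδ, -⟩ := 𝒮.exists_desc (C := RingCat.of C) _ (𝒮.ofHom_algebraMap C)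
  have e : θ.comp δ = RingHom.id _ := hom_ext (by
    rw [RingHom.comp_assoc, hδ]
    exact hθ)
  obtain ⟨⟨a, s⟩, h⟩ := IsLocalization.surj 𝒮.units (δ y : C)
  have h1 := congrArg θ h
  rw [map_mul, show θ (δ y) = y from RingHom.congr_fun e y] at h1
  have h2 (a : A) : θ (algebraMap A C a) = 𝒮.of a := RingHom.congr_fun hθ a
  rw [h2, h2] at h1
  exact ⟨s, s.2, a, (𝒮.mul_comm (fun x y : A => _root_.mul_comm x y) _ _).trans h1⟩

/-- The map `δ : A_𝒮 → C` under `A` shows that whatever dies in `A_𝒮` already dies in the ordinary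
localization. -/
theorem exists_mul_eq_zero (𝒮 : FISystem (RingCat.of A)) (x : A) (hx : 𝒮.of x = 0) :
    ∃ s ∈ 𝒮.units, s * x = 0 := by
  let C := Localization 𝒮.units
  obtain ⟨θ, hθ, hl⟩ := 𝒮.exists_localization_hom C
  have hC : Nontrivial C := θ.domain_nontrivial
  have : Nontrivial (RingCat.of C) := hC
  obtain ⟨δ, hδ, -⟩ := 𝒮.exists_desc (C := RingCat.of C) _ (𝒮.ofHom_algebraMap C)
  have h1 : algebraMap A C x = 0 := by
    rw [← show δ (𝒮.of x) = algebraMap A C x from RingHom.congr_fun hδ x, hx, map_zero]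
  obtain ⟨s, hs⟩ := (IsLocalization.map_eq_zero_iff 𝒮.units C x).1 h1
  exact ⟨s, s.2, hs⟩

end FISystem

end FSch

namespace FSch

open FISystem

/-! ## Local rings and local homomorphisms -/

/-- If `a + b = 1`, then `f a` or `f b` is a unit, and `f` reflects this. Locality thus descends
from target to source, which is why local morphisms preserve local points. -/
theorem isLocalRing_of_isLocalHom {R S : Type*} [Ring R] [Ring S] (f : R →+* S) [IsLocalHom f]
    [IsLocalRing S] : IsLocalRing R where
  toNontrivial := f.domain_nontrivial
  isUnit_or_isUnit_of_add_one {a b} h :=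
    (IsLocalRing.isUnit_or_isUnit_of_add_one
      (show f a + f b = 1 by rw [← map_add, h, map_one])).imp
      (isUnit_of_map_unit f a) (isUnit_of_map_unit f b)

theorem isLocalRing_iff_of_ringEquiv {R S : Type*} [Ring R] [Ring S] (e : R ≃+* S) :
    IsLocalRing R ↔ IsLocalRing S :=
  ⟨fun _ => have : IsLocalHom (e.symm : S →+* R) := ⟨fun _ => (isUnit_map_iff e.symm _).1⟩
    isLocalRing_of_isLocalHom (e.symm : S →+* R),
  fun _ => have : IsLocalHom (e : R →+* S) := ⟨fun _ => (isUnit_map_iff e _).1⟩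
    isLocalRing_of_isLocalHom (e : R →+* S)⟩

theorem isLocalHom_hom_of_isIso {R S : RingCat.{u}} (f : R ⟶ S) [IsIso f] : IsLocalHom f.hom :=
  ⟨fun _ => (isUnit_map_iff (asIso f).ringCatIsoToRingEquiv _).1⟩

/-! ## Evaluation of germs -/

/-- A fraction `𝒶` and an element `b` of `A_𝒶` define a section over `D(𝒶)`. -/
def Fraction.section {A : RingCat.{u}} (𝒶 : Fraction A) (b : 𝒶.ring) :
    sections A ⟨𝒶.D, isOpen_generateFrom_of_mem ⟨𝒶, rfl⟩⟩ :=
  ⟨fun 𝒮 => 𝒶.lift _ 𝒮.2 b, fun 𝒮 => ⟨_, 𝒮.2, 𝟙 _, 𝒶, b, fun 𝒯 => ⟨𝒯.2, rfl⟩⟩⟩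

/-- The value of a germ of the structure sheaf of `F(A)` at `𝒮`. -/
def evalStalk {A : RingCat.{u}} (𝒮 : FISystem A) : (F A).presheaf.stalk 𝒮 ⟶ 𝒮.ring :=
  colimit.desc ((OpenNhds.inclusion (X := FTop A) 𝒮).op ⋙ (F A).presheaf)
    { pt := 𝒮.ring
      ι :=
        { app := fun U => RingCat.ofHom
            ((Pi.evalRingHom (fun 𝒯 : U.unop.1 => (FISystem.ring 𝒯.1 : Type u))
              ⟨𝒮, U.unop.2⟩).comp (sections A U.unop.1).subtype)
          naturality := fun _ _ _ => rfl } }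

theorem evalStalk_germ {A : RingCat.{u}} (𝒮 : FISystem A) (U : Opens (FTop A)) (h : 𝒮 ∈ U)
    (t : sections A U) :
    (evalStalk 𝒮).hom (((F A).presheaf.germ U 𝒮 h).hom t) = t.1 ⟨𝒮, h⟩ :=
  RingHom.congr_fun (congrArg RingCat.Hom.hom
    (colimit.ι_desc (F := (OpenNhds.inclusion (X := FTop A) 𝒮).op ⋙ (F A).presheaf) _ (op ⟨U, h⟩))) t

variable {A : Type u} [CommRing A]

/-- Near `𝒮` a section has the form `x/d`. If its value at `𝒮` vanishes, some `s` invertible at `𝒮`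
kills `x`, and the section vanishes wherever `s` is invertible. Conversely, an element `a/s` of
`A_𝒮` is the value of the section `s⁻¹a` over the open set of the one-term fraction `(s)`. -/
theorem evalStalk_bijective (𝒮 : FISystem (RingCat.of A)) :
    Function.Bijective (evalStalk 𝒮).hom := by
  constructor
  · rw [injective_iff_map_eq_zero]
    intro x hx
    obtain ⟨U, h𝒮, t, rfl⟩ := (F (RingCat.of A)).presheaf.exists_germ_eq x
    have hx' : t.1 ⟨𝒮, h𝒮⟩ = 0 := (evalStalk_germ 𝒮 U h𝒮 t).symm.trans hx
    obtain ⟨W, hW, i, 𝒶, b, H⟩ := t.2 ⟨𝒮, h𝒮⟩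
    obtain ⟨d, x, hd⟩ := Fraction.exists_eq_div (A := RingCat.of A)
      (fun x y : A => mul_comm x y) 𝒶 b
    have h0 : 𝒮.of x = 0 := by
      obtain ⟨hi, e⟩ := H ⟨𝒮, hW⟩
      rw [← (hd 𝒮.of).2 hi, ← e]
      exact (congrArg (𝒮.of d * ·) hx').trans (mul_zero _)
    obtain ⟨s, hs, hsx⟩ := 𝒮.exists_mul_eq_zero x h0
    let 𝒷 : Fraction (RingCat.of A) := .cons s (.nil _)
    let V : Opens (FTop (RingCat.of A)) :=
      W ⊓ ⟨𝒷.D, isOpen_generateFrom_of_mem ⟨𝒷, rfl⟩⟩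
    have hV : 𝒮 ∈ V := ⟨hW, hs, trivial⟩
    have hVU : V ≤ U := inf_le_left.trans i.le
    have key : ((F (RingCat.of A)).presheaf.map (homOfLE hVU).op).hom t = 0 := by
      refine Subtype.ext (funext fun 𝒯 => ?_)
      obtain ⟨hi, e⟩ := H ⟨𝒯.1, 𝒯.2.1⟩
      have hs' : IsUnit (𝒯.1.of s) := 𝒯.2.2.1
      have e1 : 𝒯.1.of x = 0 := by
        rw [← hs'.mul_right_eq_zero, ← map_mul]
        exact (congrArg 𝒯.1.of hsx).trans (map_zero _)
      have e2 := (hd 𝒯.1.of).2 hi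
      rw [e1, ((hd 𝒯.1.of).1.1 hi).mul_right_eq_zero] at e2
      exact e.trans e2
    have := TopCat.Presheaf.germ_res_apply (F (RingCat.of A)).presheaf (homOfLE hVU) 𝒮 hV t
    exact this.symm.trans ((congrArg _ key).trans (map_zero _))
  · intro y
    obtain ⟨s, hs, a, h⟩ := 𝒮.exists_of_mul_eq y
    let 𝒷 : Fraction (RingCat.of A) := .cons s (.nil _)
    obtain ⟨u, hu⟩ := Loc.isUnit_of (Set.mem_singleton s)
    let b : Loc A {s} := ((u⁻¹ : (Loc A {s})ˣ) : Loc A {s}) * Loc.of {s} a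
    have h𝒮 : 𝒮 ∈ 𝒷.D := ⟨hs, trivial⟩
    refine ⟨((F (RingCat.of A)).presheaf.germ _ 𝒮 h𝒮).hom (Fraction.section 𝒷 b), ?_⟩
    rw [evalStalk_germ]
    refine (mem_units.1 hs).mul_left_cancel (Eq.trans ?_ h.symm)
    have e : Loc.of {s} s * b = Loc.of {s} a := by
      rw [← hu]
      exact u.mul_inv_cancel_left _
    have := congrArg (Loc.lift 𝒮.of (Fraction.isUnit_of_mem_singleton hs)) e
    rw [map_mul, Loc.lift_of, Loc.lift_of] at this
    exact this

/-- For commutative `A`, the stalk of the structure sheaf of `F(A)` at `𝒮` is `A_𝒮`. -/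
def stalkEquiv (𝒮 : FISystem (RingCat.of A)) :
    (F (RingCat.of A)).presheaf.stalk 𝒮 ≃+* 𝒮.ring :=
  RingEquiv.ofBijective (evalStalk 𝒮).hom (evalStalk_bijective 𝒮)

/-! ## The systems given by prime ideals -/

open StructureSheaf (Localizations)

/-- The fully invertible system given by a prime ideal `P`; it comes from `A → A_P`. -/
def primeSystem (P : PrimeSpectrum A) : FISystem (RingCat.of A) :=
  haveI : Nontrivial (RingCat.of (Localizations A P)) :=
    inferInstanceAs (Nontrivial (Localization.AtPrime P.asIdeal))
  ofHom (A := RingCat.of A) (B := RingCat.of (Localizations A P)) (algebraMap A (Localizations A P))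

instance (P : PrimeSpectrum A) : IsLocalization.AtPrime (Localizations A P) P.asIdeal :=
  inferInstanceAs (IsLocalization.AtPrime (Localization.AtPrime P.asIdeal) P.asIdeal)

instance (P : PrimeSpectrum A) : Nontrivial (Localizations A P) :=
  inferInstanceAs (Nontrivial (Localization.AtPrime P.asIdeal))

/-- The map `A_𝒮 → A_P`, where `𝒮` is given by `P`. -/
def primeDesc (P : PrimeSpectrum A) : (primeSystem P).ring →+* Localizations A P :=
  haveI : Nontrivial (RingCat.of (Localizations A P)) :=
    inferInstanceAs (Nontrivial (Localizations A P))
  desc (A := RingCat.of A) (B := RingCat.of (Localizations A P)) (algebraMap A (Localizations A P))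

theorem primeDesc_of (P : PrimeSpectrum A) (a : A) :
    primeDesc P ((primeSystem P).of a) = algebraMap A (Localizations A P) a :=
  haveI : Nontrivial (RingCat.of (Localizations A P)) :=
    inferInstanceAs (Nontrivial (Localizations A P))
  desc_of (A := RingCat.of A) (B := RingCat.of (Localizations A P))
    (algebraMap A (Localizations A P)) a

theorem isLocalHom_primeDesc (P : PrimeSpectrum A) : IsLocalHom (primeDesc P) :=
  haveI : Nontrivial (RingCat.of (Localizations A P)) :=
    inferInstanceAs (Nontrivial (Localizations A P))
  isLocalHom_desc (A := RingCat.of A) (B := RingCat.of (Localizations A P)) _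

theorem first_primeSystem (P : PrimeSpectrum A) :
    first (primeSystem P) = {a : A | a ∉ P.asIdeal} :=
  Set.ext fun a => IsLocalization.AtPrime.isUnit_to_map_iff (Localizations A P) P.asIdeal a

theorem mem_units_primeSystem {P : PrimeSpectrum A} {a : A} :
    a ∈ (primeSystem P).units ↔ a ∉ P.asIdeal := by
  have := isLocalHom_primeDesc P
  rw [mem_units, ← isUnit_map_iff (primeDesc P)]
  exact (iff_of_eq (congrArg IsUnit (primeDesc_of P a))).trans
    (IsLocalization.AtPrime.isUnit_to_map_iff (Localizations A P) P.asIdeal a)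

theorem primeDesc_bijective (P : PrimeSpectrum A) : Function.Bijective (primeDesc P) := by
  constructor
  · rw [injective_iff_map_eq_zero]
    intro y hy
    obtain ⟨s, hs, a, h⟩ := (primeSystem P).exists_of_mul_eq y
    have h1 : algebraMap A (Localizations A P) a = 0 := by
      rw [← primeDesc_of, ← h, map_mul, hy, mul_zero]
    obtain ⟨⟨t, ht⟩, hta⟩ :=
      (IsLocalization.map_eq_zero_iff P.asIdeal.primeCompl (Localizations A P) a).1 h1
    have h2 : (primeSystem P).of a = 0 := by
      rw [← (mem_units.1 (mem_units_primeSystem.2 ht)).mul_right_eq_zero, ← map_mul]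
      exact (congrArg (primeSystem P).of hta).trans (map_zero _)
    rwa [h2, (mem_units.1 hs).mul_right_eq_zero] at h
  · intro z
    obtain ⟨⟨a, s⟩, h⟩ := IsLocalization.surj P.asIdeal.primeCompl z
    obtain ⟨u, hu⟩ := mem_units.1 (mem_units_primeSystem.2 s.2)
    refine ⟨(u⁻¹ : (primeSystem P).ringˣ) * (primeSystem P).of a, ?_⟩
    refine (IsLocalization.map_units (Localizations A P) s).mul_left_cancel ?_
    rw [mul_comm _ z, h, ← primeDesc_of, ← map_mul, ← hu, Units.mul_inv_cancel_left, primeDesc_of]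

theorem primeSystem_injective : Function.Injective (primeSystem (A := A)) := by
  intro P Q h
  ext a
  have : a ∈ (primeSystem P).units ↔ a ∈ (primeSystem Q).units := by rw [h]
  rwa [mem_units_primeSystem, mem_units_primeSystem, not_iff_not] at this

theorem isLocalRing_primeSystem (P : PrimeSpectrum A) : IsLocalRing (primeSystem P).ring :=
  have : IsLocalRing (Localizations A P) := IsLocalization.AtPrime.isLocalRing _ P.asIdeal
  have := isLocalHom_primeDesc P
  isLocalRing_of_isLocalHom (primeDesc P)

/-- For `P` the preimage of the maximal ideal of `A_𝒮`, the complement of `P` is exactly the set of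
elements which become units, so `A_P` is the localization from which `𝒮` comes. -/
theorem exists_eq_primeSystem (𝒮 : FISystem (RingCat.of A)) (h : IsLocalRing 𝒮.ring) :
    ∃ P, primeSystem P = 𝒮 := by
  let _ := 𝒮.commRing
  let P : PrimeSpectrum A := PrimeSpectrum.comap (S := 𝒮.ring) 𝒮.of
    ⟨IsLocalRing.maximalIdeal 𝒮.ring, inferInstance⟩
  refine ⟨P, ?_⟩
  have hP : P.asIdeal.primeCompl = 𝒮.units := by
    ext a
    change ¬ (𝒮.of a ∈ IsLocalRing.maximalIdeal 𝒮.ring) ↔ IsUnit (𝒮.of a)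
    rw [IsLocalRing.mem_maximalIdeal, mem_nonunits_iff, not_not]
  have : IsLocalization 𝒮.units (Localizations A P) :=
    hP ▸ inferInstanceAs (IsLocalization P.asIdeal.primeCompl (Localizations A P))
  exact 𝒮.ofHom_algebraMap (Localizations A P)

theorem preimage_D_eq (𝒶 : Fraction (RingCat.of A)) :
    ∃ d : A, primeSystem ⁻¹' 𝒶.D = PrimeSpectrum.basicOpen d := by
  -- Only the denominator matters here, so the element of `A_𝒶` may be taken to be `0`.
  obtain ⟨d, x, H⟩ := Fraction.exists_eq_div (A := RingCat.of A)
    (fun x y : A => mul_comm x y) 𝒶 0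
  exact ⟨d, Set.ext fun P => (H (primeSystem P).of).1.trans mem_units_primeSystem⟩

theorem isInducing_primeSystem : Topology.IsInducing (primeSystem (A := A)) := by
  refine ⟨le_antisymm ?_ ?_⟩
  · refine Continuous.le_induced (continuous_generateFrom_iff.2 ?_)
    rintro _ ⟨𝒶, rfl⟩
    obtain ⟨d, hd⟩ := preimage_D_eq 𝒶
    rw [hd]
    exact (PrimeSpectrum.basicOpen d).2
  · rw [PrimeSpectrum.isTopologicalBasis_basic_opens.eq_generateFrom]
    refine le_generateFrom ?_
    rintro _ ⟨a, rfl⟩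
    let 𝒶 : Fraction (RingCat.of A) := .cons a (.nil _)
    refine ⟨𝒶.D, isOpen_generateFrom_of_mem ⟨𝒶, rfl⟩, Set.ext fun P => ?_⟩
    exact (exists_prop.trans ((iff_of_eq (and_true _)).trans mem_units_primeSystem))

/-- Puts a value presented by `x/d` into the `LocalizedModule` form in which the structure sheaf of
`Spec(A)` expects local fractions. -/
theorem primeDesc_eq_mk (P : PrimeSpectrum A) (y : (primeSystem P).ring) (x d : A)
    (hd : d ∉ P.asIdeal) (h : (primeSystem P).of d * y = (primeSystem P).of x) :
    primeDesc P y = LocalizedModule.mk x ⟨d, hd⟩ := by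
  have e : Localization.mk x ⟨d, hd⟩ = (LocalizedModule.mk x ⟨d, hd⟩ : Localizations A P) := rfl
  have e1 := congrArg (primeDesc P) h
  rw [map_mul, primeDesc_of, primeDesc_of] at e1
  rw [← e, Localization.mk_eq_mk', IsLocalization.eq_mk'_iff_mul_eq]
  exact (_root_.mul_comm _ _).trans e1

/-! ## The morphism from the prime spectrum to the full spectrum -/

/-- A section `t` of the structure sheaf of `F(A)` is sent to the function `P ↦ t(𝒮) ∈ A_P`, where
`𝒮` is given by `P`. -/
def primeSections (U : Opens (FTop (RingCat.of A))) (V : Opens (PrimeSpectrum.Top A))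
    (h : ∀ P ∈ V, primeSystem P ∈ U) :
    sections (RingCat.of A) U →+* StructureSheaf.sectionsSubalgebra (R := A) A V where
  toFun t := ⟨fun P => primeDesc P.1 (t.1 ⟨primeSystem P.1, h P.1 P.2⟩), by
    intro P
    obtain ⟨W, hW, i, 𝒶, b, H⟩ := t.2 ⟨primeSystem P.1, h P.1 P.2⟩
    obtain ⟨d, x, hd⟩ := Fraction.exists_eq_div (A := RingCat.of A)
      (fun x y : A => mul_comm x y) 𝒶 b
    refine ⟨V ⊓ ⟨primeSystem ⁻¹' W, W.2.preimage isInducing_primeSystem.continuous⟩,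
      ⟨P.2, hW⟩, Opens.infLELeft _ _, x, d, fun Q => ?_⟩
    obtain ⟨hi, e⟩ := H ⟨primeSystem Q.1, Q.2.2⟩
    change t.1 ⟨primeSystem Q.1, _⟩ = _ at e
    have hdQ : d ∉ Q.1.asIdeal := mem_units_primeSystem.1 ((hd _).1.1 hi)
    refine ⟨hdQ, ?_⟩
    exact primeDesc_eq_mk _ _ x d hdQ ((congrArg (_ * ·) e).trans ((hd (primeSystem Q.1).of).2 hi))⟩
  map_one' := Subtype.ext (funext fun _ => map_one _)
  map_zero' := Subtype.ext (funext fun _ => map_zero _)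
  map_mul' _ _ := Subtype.ext (funext fun _ => map_mul _ _ _)
  map_add' _ _ := Subtype.ext (funext fun _ => map_add _ _ _)

/-- The morphism `f_A : Spec(A) → F(A)`. -/
def specToF (A : CommRingCat.{u}) : ofScheme (Spec A) ⟶ F (RingCat.of A) :=
  InducedCategory.homMk
    { base := TopCat.ofHom ⟨primeSystem, isInducing_primeSystem.continuous⟩
      c :=
        { app := fun U => RingCat.ofHom (primeSections U.unop _ fun _ h => h)
          naturality := fun _ _ _ => rfl } }

/-- The value of a germ of the structure sheaf of `Spec(A)` at `P`. -/
def evalSpecStalk (A : CommRingCat.{u}) (P : PrimeSpectrum.Top A) :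
    (ofScheme (Spec A)).presheaf.stalk P ⟶ RingCat.of (Localizations A P) :=
  colimit.desc ((OpenNhds.inclusion (X := PrimeSpectrum.Top A) P).op ⋙
      (ofScheme (Spec A)).presheaf)
    { pt := RingCat.of (Localizations A P)
      ι :=
        { app := fun U => RingCat.ofHom
            ((Pi.evalRingHom (fun Q : U.unop.1 => (Localizations A Q.1 : Type u))
              ⟨P, U.unop.2⟩).comp
                (StructureSheaf.sectionsSubalgebra (R := A) A U.unop.1).val.toRingHom)
          naturality := fun _ _ _ => rfl } }

theorem evalSpecStalk_germ (A : CommRingCat.{u}) (P : PrimeSpectrum.Top A)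
    (U : Opens (PrimeSpectrum.Top A)) (h : P ∈ U)
    (t : StructureSheaf.sectionsSubalgebra (R := A) A U) :
    (evalSpecStalk A P).hom (((ofScheme (Spec A)).presheaf.germ U P h).hom t) = t.1 ⟨P, h⟩ :=
  RingHom.congr_fun (congrArg RingCat.Hom.hom
    (colimit.ι_desc (F := (OpenNhds.inclusion (X := PrimeSpectrum.Top A) P).op ⋙
      (ofScheme (Spec A)).presheaf) _ (op ⟨U, h⟩))) t

/-- If `a/s` vanishes in `A_P`, an element `c ∉ P` witnesses this by an equation in `A`, which makes
the section vanish on all of `D(cs)` inside `W`. -/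
theorem evalSpecStalk_injective (A : CommRingCat.{u}) (P : PrimeSpectrum A) :
    Function.Injective (evalSpecStalk A P).hom := by
  rw [injective_iff_map_eq_zero]
  intro x hx
  obtain ⟨U, hP, t, rfl⟩ := (ofScheme (Spec A)).presheaf.exists_germ_eq x
  have hx' : t.1 ⟨P, hP⟩ = 0 := (evalSpecStalk_germ A P U hP t).symm.trans hx
  obtain ⟨W, hW, i, a, s, H⟩ := t.2 ⟨P, hP⟩
  obtain ⟨hs, e⟩ := H ⟨P, hW⟩
  have e' : (LocalizedModule.mk a ⟨s, hs⟩ : Localizations A P) = 0 := e.symm.trans hx'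
  rw [← LocalizedModule.zero_mk ⟨s, hs⟩, LocalizedModule.mk_eq] at e'
  obtain ⟨⟨c, hc⟩, hcs⟩ := e'
  let V : Opens (PrimeSpectrum.Top A) := W ⊓ PrimeSpectrum.basicOpen (c * s)
  have hV : P ∈ V := ⟨hW, P.asIdeal.primeCompl.mul_mem hc hs⟩
  have hVU : V ≤ U := inf_le_left.trans i.le
  have key : ((ofScheme (Spec A)).presheaf.map (homOfLE hVU).op).hom t = 0 := by
    refine Subtype.ext (funext fun Q => ?_)
    obtain ⟨hs', e1⟩ := H ⟨Q.1, Q.2.1⟩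
    refine e1.trans ?_
    change (LocalizedModule.mk a ⟨s, hs'⟩ : Localizations A Q.1) = 0
    have hc' : c ∉ Q.1.asIdeal := fun h => Q.2.2 (Ideal.mul_mem_right _ _ h)
    rw [← LocalizedModule.zero_mk ⟨s, hs'⟩, LocalizedModule.mk_eq]
    exact ⟨⟨c, hc'⟩, hcs⟩
  have := TopCat.Presheaf.germ_res_apply (ofScheme (Spec A)).presheaf (homOfLE hVU) P hV t
  exact this.symm.trans ((congrArg _ key).trans (map_zero _))

theorem evalSpecStalk_stalkMap (A : CommRingCat.{u}) (P : PrimeSpectrum A)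
    (x : (F (RingCat.of A)).presheaf.stalk (primeSystem P)) :
    (evalSpecStalk A P).hom (((specToF A).hom.stalkMap P).hom x) =
      primeDesc P ((evalStalk (primeSystem P)).hom x) := by
  obtain ⟨U, hU, t, rfl⟩ := (F (RingCat.of A)).presheaf.exists_germ_eq x
  have h := PresheafedSpace.stalkMap_germ_apply (specToF A).hom U P hU t
  refine (congrArg (evalSpecStalk A P).hom h).trans ?_
  refine (evalSpecStalk_germ A P _ hU _).trans ?_
  exact (congrArg (primeDesc P) (evalStalk_germ _ U hU t)).symm

/-- Followed by the injective evaluation on `Spec(A)`, the stalk map becomes the composite of the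
bijections from the stalk of `F(A)` to `A_𝒮` and on to `A_P`. Surjectivity of that evaluation is not
needed separately. -/
theorem stalkMap_specToF_bijective (A : CommRingCat.{u}) (P : PrimeSpectrum A) :
    Function.Bijective ((specToF A).hom.stalkMap P).hom := by
  have h : Function.Bijective ((evalSpecStalk A P).hom ∘ ((specToF A).hom.stalkMap P).hom) := by
    rw [show (evalSpecStalk A P).hom ∘ ((specToF A).hom.stalkMap P).hom =
      primeDesc P ∘ (evalStalk (primeSystem P)).hom from funext (evalSpecStalk_stalkMap A P)]
    exact (primeDesc_bijective P).comp (evalStalk_bijective _)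
  refine ⟨h.1.of_comp, fun y => ?_⟩
  obtain ⟨x, hx⟩ := h.2 ((evalSpecStalk A P).hom y)
  exact ⟨x, evalSpecStalk_injective A P hx⟩

theorem isIso_stalkMap_specToF (A : CommRingCat.{u}) (P : ofScheme (Spec A)) :
    IsIso ((specToF A).hom.stalkMap P) :=
  (ConcreteCategory.isIso_iff_bijective _).2 (stalkMap_specToF_bijective A P)

theorem isEmbedding_specToF (A : CommRingCat.{u}) :
    Topology.IsEmbedding (specToF A).hom.base :=
  ⟨isInducing_primeSystem, primeSystem_injective⟩

theorem range_specToF (A : CommRingCat.{u}) :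
    Set.range (specToF A).hom.base =
      {x | IsLocalRing ((F (RingCat.of A)).presheaf.stalk x)} := by
  ext 𝒮
  constructor
  · rintro ⟨P, rfl⟩
    exact (isLocalRing_iff_of_ringEquiv (stalkEquiv (primeSystem P))).2 (isLocalRing_primeSystem P)
  · intro h
    exact exists_eq_primeSystem 𝒮 ((isLocalRing_iff_of_ringEquiv (stalkEquiv 𝒮)).1 h)

theorem isLocalMor_specToF (A : CommRingCat.{u}) : IsLocalMor (specToF A) := fun P =>
  have := isIso_stalkMap_specToF A P
  isLocalHom_hom_of_isIso _

/-! ## Naturality -/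

/-- Both systems come from `A → B_P`: this map factors through the local homomorphism `A_Q → B_P`,
and also through the local map to `B_P` from the localization of `B` at the system of `P`. -/
theorem primeSystem_comap {A B : CommRingCat.{u}} (φ : A ⟶ B) (P : PrimeSpectrum B) :
    primeSystem (PrimeSpectrum.comap φ.hom P) =
      comap (A := RingCat.of A) (B := RingCat.of B) φ.hom (primeSystem P) := by
  let Q := PrimeSpectrum.comap φ.hom P
  let R : RingCat.{u} := RingCat.of (Localization.AtPrime P.asIdeal)
  let R' : RingCat.{u} := RingCat.of (Localization.AtPrime Q.asIdeal)
  have : Nontrivial R := inferInstanceAs (Nontrivial (Localization.AtPrime P.asIdeal))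
  have : Nontrivial R' := inferInstanceAs (Nontrivial (Localization.AtPrime Q.asIdeal))
  let f : RingCat.of A →+* RingCat.of B := φ.hom
  let i : RingCat.of B →+* R := algebraMap B (Localization.AtPrime P.asIdeal)
  let j : RingCat.of A →+* R' := algebraMap A (Localization.AtPrime Q.asIdeal)
  let l : R' →+* R := Localization.localRingHom Q.asIdeal P.asIdeal φ.hom rfl
  have hl : IsLocalHom l := Localization.isLocalHom_localRingHom _ _ _ _
  have e1 : l.comp j = i.comp f :=
    RingHom.ext fun a => Localization.localRingHom_to_map Q.asIdeal P.asIdeal φ.hom rfl a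
  have e2 : (desc i).comp ((ofHom i).of.comp f) = i.comp f := by
    rw [← RingHom.comp_assoc, desc_comp_of]
  have h1 : ofHom (l.comp j) = ofHom j := ofHom_comp j l hl
  have h2 := ofHom_comp ((ofHom i).of.comp f) (desc i) (isLocalHom_desc i)
  exact h1.symm.trans ((congrArg (fun g => ofHom g) (e1.trans e2.symm)).trans h2)

/-- The two values of `t` lie over points which are equal only propositionally; `hom_congr` reduces
the comparison to elements of `A`. -/
theorem comap_primeSections {A B : CommRingCat.{u}} (φ : A ⟶ B) (P : PrimeSpectrum B)
    (U : Opens (FTop (RingCat.of A))) (t : sections (RingCat.of A) U)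
    (h : primeSystem (PrimeSpectrum.comap φ.hom P) ∈ U)
    (h' : comap (A := RingCat.of A) (B := RingCat.of B) φ.hom (primeSystem P) ∈ U) :
    Localization.localRingHom (PrimeSpectrum.comap φ.hom P).asIdeal P.asIdeal φ.hom rfl
        (primeDesc _ (t.1 ⟨_, h⟩)) =
      primeDesc P (comapMap (A := RingCat.of A) (B := RingCat.of B) φ.hom (primeSystem P)
        (t.1 ⟨_, h'⟩)) := by
  refine hom_congr (ι := fun x : U => x.1) t.1 (x := ⟨_, h⟩) (y := ⟨_, h'⟩)
    (Subtype.ext (primeSystem_comap φ P))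
    ((Localization.localRingHom (PrimeSpectrum.comap φ.hom P).asIdeal P.asIdeal φ.hom rfl).comp
      (primeDesc _))
    ((primeDesc P).comp
      (comapMap (A := RingCat.of A) (B := RingCat.of B) φ.hom (primeSystem P))) ?_
  refine RingHom.ext fun a => ?_
  refine (congrArg (Localization.localRingHom (PrimeSpectrum.comap φ.hom P).asIdeal P.asIdeal
    φ.hom rfl) (primeDesc_of (PrimeSpectrum.comap φ.hom P) a)).trans ?_
  refine (Localization.localRingHom_to_map _ P.asIdeal φ.hom rfl a).trans ?_
  refine (primeDesc_of P (φ.hom a)).symm.trans ?_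
  exact (congrArg (primeDesc P) (desc_of (A := RingCat.of A) (B := (primeSystem P).ring)
    ((primeSystem P).of.comp φ.hom) a)).symm

theorem specToF_naturality {A B : CommRingCat.{u}} (φ : A ⟶ B) :
    ofSchemeMap (Spec.map φ) ≫ specToF A =
      specToF B ≫ F.map (A := RingCat.of A) (B := RingCat.of B) (RingCat.ofHom φ.hom) := by
  have hb : (ofSchemeMap (Spec.map φ) ≫ specToF A).hom.base =
      (specToF B ≫ F.map (A := RingCat.of A) (B := RingCat.of B)
        (RingCat.ofHom φ.hom)).hom.base :=
    TopCat.hom_ext (ContinuousMap.ext fun P => primeSystem_comap φ P)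
  refine SheafedSpace.ext _ _ hb ?_
  refine NatTrans.ext (funext fun U => RingCat.hom_ext (RingHom.ext fun t => ?_))
  refine Subtype.ext (funext fun P => ?_)
  -- The two base maps agree only propositionally, so membership in the preimage of `U` must be
  -- carried along `hb`.
  have hP : P.1 ∈ (Opens.map (ofSchemeMap (Spec.map φ) ≫ specToF A).hom.base).obj U.unop := by
    rw [hb]
    exact P.2
  refine (StructureSheaf.comap_apply φ.hom ((Opens.map (specToF A).hom.base).obj U.unop)
    ((Opens.map (ofSchemeMap (Spec.map φ) ≫ specToF A).hom.base).obj U.unop) (fun _ h => h)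
    (primeSections U.unop _ (fun _ h => h) t) ⟨P.1, hP⟩).trans ?_
  exact comap_primeSections φ P.1 U.unop t _ _

end FSch

namespace FSch

/-! ## Stalks of the inverse image of a sheaf -/

/-- Uniqueness of left adjoints identifies the unit for sheaves with the unit for presheaves
followed by sheafification. -/
theorem pullback_unit_comp_iso {X Y : TopCat.{u}} (f : X ⟶ Y) (G : TopCat.Sheaf RingCat.{u} Y) :
    ((TopCat.Sheaf.pullbackPushforwardAdjunction RingCat.{u} f).unit.app G).hom ≫
      (TopCat.Presheaf.pushforward RingCat.{u} f).map
        ((TopCat.Sheaf.pullbackIso RingCat.{u} f).hom.app G).hom =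
    (TopCat.Presheaf.pullbackPushforwardAdjunction RingCat.{u} f).unit.app G.obj ≫
      (TopCat.Presheaf.pushforward RingCat.{u} f).map
        (toSheafify (Opens.grothendieckTopology X)
          ((TopCat.Presheaf.pullback RingCat.{u} f).obj G.obj)) := by
  have h := Adjunction.unit_leftAdjointUniq_hom_app
    (TopCat.Sheaf.pullbackPushforwardAdjunction RingCat.{u} f)
    (Functor.sheafPullbackConstruction.sheafAdjunctionContinuous (Opens.map f) RingCat.{u}
      (Opens.grothendieckTopology Y) (Opens.grothendieckTopology X)) G
  have h' := congrArg (fun k => k.hom) h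
  refine Eq.trans h' ?_
  simp [Functor.sheafPullbackConstruction.sheafAdjunctionContinuous]
  rfl

/-- The map on stalks given by a morphism `α : G → f_* H` of presheaves. -/
def stalkHom {X Y : TopCat.{u}} (f : X ⟶ Y) {G : Y.Presheaf RingCat.{u}}
    {H : X.Presheaf RingCat.{u}} (α : G ⟶ (TopCat.Presheaf.pushforward RingCat.{u} f).obj H)
    (x : X) : G.stalk (f x) ⟶ H.stalk x :=
  (TopCat.Presheaf.stalkFunctor RingCat.{u} (f x)).map α ≫
    TopCat.Presheaf.stalkPushforward RingCat.{u} f H x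

theorem germ_stalkHom {X Y : TopCat.{u}} (f : X ⟶ Y) {G : Y.Presheaf RingCat.{u}}
    {H : X.Presheaf RingCat.{u}} (α : G ⟶ (TopCat.Presheaf.pushforward RingCat.{u} f).obj H)
    (x : X) (U : Opens Y) (hU : f x ∈ U) :
    G.germ U (f x) hU ≫ stalkHom f α x = α.app (op U) ≫ H.germ ((Opens.map f).obj U) x hU :=
  PresheafedSpace.stalkMap_germ (X := ⟨X, H⟩) (Y := ⟨Y, G⟩) ⟨f, α⟩ U x hU

theorem stalkHom_comp {X Y : TopCat.{u}} (f : X ⟶ Y) {G : Y.Presheaf RingCat.{u}}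
    {H H' : X.Presheaf RingCat.{u}} (α : G ⟶ (TopCat.Presheaf.pushforward RingCat.{u} f).obj H)
    (k : H ⟶ H') (x : X) :
    stalkHom f α x ≫ (TopCat.Presheaf.stalkFunctor RingCat.{u} x).map k =
      stalkHom f (α ≫ (TopCat.Presheaf.pushforward RingCat.{u} f).map k) x := by
  refine TopCat.Presheaf.stalk_hom_ext _ fun U hU => ?_
  refine Eq.trans ?_ (germ_stalkHom f _ x U hU).symm
  refine (Category.assoc _ _ _).symm.trans ?_
  refine (congrArg (· ≫ (TopCat.Presheaf.stalkFunctor RingCat.{u} x).map k)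
    (germ_stalkHom f α x U hU)).trans ?_
  refine (Category.assoc _ _ _).trans ?_
  refine (congrArg (α.app (op U) ≫ ·)
    (TopCat.Presheaf.stalkFunctor_map_germ ((Opens.map f).obj U) x hU k)).trans ?_
  exact (Category.assoc _ _ _).symm

/-- Neither presheaf pullback nor sheafification changes stalks, and `pullback_unit_comp_iso`
expresses the sheaf unit through these two, up to an isomorphism. -/
theorem isIso_stalkHom_pullback_unit {X Y : TopCat.{u}} (f : X ⟶ Y)
    (G : TopCat.Sheaf RingCat.{u} Y) (x : X) :
    IsIso (stalkHom f (H := ((TopCat.Sheaf.pullback RingCat.{u} f).obj G).obj)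
      ((TopCat.Sheaf.pullbackPushforwardAdjunction RingCat.{u} f).unit.app G).hom x) := by
  have h1 := stalkHom_comp f
    ((TopCat.Sheaf.pullbackPushforwardAdjunction RingCat.{u} f).unit.app G).hom
    ((TopCat.Sheaf.pullbackIso RingCat.{u} f).hom.app G).hom x
  have h2 := stalkHom_comp f
    ((TopCat.Presheaf.pullbackPushforwardAdjunction RingCat.{u} f).unit.app G.obj)
    (toSheafify (Opens.grothendieckTopology X)
      ((TopCat.Presheaf.pullback RingCat.{u} f).obj G.obj)) x
  have h3 : IsIso (stalkHom f
      ((TopCat.Presheaf.pullbackPushforwardAdjunction RingCat.{u} f).unit.app G.obj) x) :=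
    (TopCat.Presheaf.stalkPullbackIso RingCat.{u} f G.obj x).isIso_hom
  have h4 := TopCat.Presheaf.stalkFunctor_map_unit_toSheafify_isIso x RingCat.{u}
    ((TopCat.Presheaf.pullback RingCat.{u} f).obj G.obj)
  have h5 : IsIso ((TopCat.Sheaf.pullbackIso RingCat.{u} f).hom.app G).hom :=
    ((sheafToPresheaf _ _).mapIso ((TopCat.Sheaf.pullbackIso RingCat.{u} f).app G)).isIso_hom
  have h6 : IsIso ((TopCat.Presheaf.stalkFunctor RingCat.{u} x).map
    ((TopCat.Sheaf.pullbackIso RingCat.{u} f).hom.app G).hom) := inferInstance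
  have h7 := h1.trans ((congrArg (fun α => stalkHom f α x) (pullback_unit_comp_iso f G)).trans
    h2.symm)
  refine @IsIso.of_isIso_comp_right _ _ _ _ _ _ _ h6 ?_
  exact (congrArg (fun k => IsIso k) h7).mpr (@IsIso.comp_isIso _ _ _ _ _ _ _ h3 h4)

theorem isIso_stalkMap_incl (X : RSpace.{u}) (x : L X) : IsIso ((L.incl X).hom.stalkMap x) :=
  isIso_stalkHom_pullback_unit (localPointsIncl X) X.sheaf x

instance (X : RSpace.{u}) : Mono (L.incl X) :=
  SheafedSpace.mono_of_base_injective_of_stalk_epi _ Subtype.val_injective fun x =>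
    have := isIso_stalkMap_incl X x
    inferInstance

/-! ## The universal property of the space of local points -/

theorem stalkMap_comp {X Y Z : RSpace.{u}} (f : X ⟶ Y) (g : Y ⟶ Z) (x : X) :
    (f ≫ g).hom.stalkMap x = g.hom.stalkMap (f.hom.base x) ≫ f.hom.stalkMap x :=
  PresheafedSpace.stalkMap.comp f.hom g.hom x

/-- A morphism whose image consists of local points, as a map into the set of local points. -/
def L.liftBase {Z X : RSpace.{u}} (m : Z ⟶ X)
    (h : ∀ z, IsLocalRing (X.presheaf.stalk (m.hom.base z))) : (Z : TopCat.{u}) ⟶ localPoints X :=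
  TopCat.ofHom ⟨fun z => ⟨m.hom.base z, h z⟩, m.hom.base.hom.continuous.subtype_mk h⟩

/-- A morphism whose image consists of local points factors through the space of local points. -/
def L.lift {Z X : RSpace.{u}} (m : Z ⟶ X)
    (h : ∀ z, IsLocalRing (X.presheaf.stalk (m.hom.base z))) : Z ⟶ L X :=
  InducedCategory.homMk
    { base := L.liftBase m h
      -- The base of `m` is `L.liftBase m h` followed by the inclusion, so the comorphism of `m`
      -- maps into a pushforward along the inclusion and can be transposed.
      c := (((TopCat.Sheaf.pullbackPushforwardAdjunction RingCat.{u}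
        (localPointsIncl X)).homEquiv X.sheaf
          ((TopCat.Sheaf.pushforward RingCat.{u} (L.liftBase m h)).obj Z.sheaf)).symm
            ⟨m.hom.c⟩).hom }

theorem L.lift_incl {Z X : RSpace.{u}} (m : Z ⟶ X)
    (h : ∀ z, IsLocalRing (X.presheaf.stalk (m.hom.base z))) : L.lift m h ≫ L.incl X = m := by
  have key := ((TopCat.Sheaf.pullbackPushforwardAdjunction RingCat.{u}
    (localPointsIncl X)).homEquiv X.sheaf
      ((TopCat.Sheaf.pushforward RingCat.{u} (L.liftBase m h)).obj Z.sheaf)).apply_symm_apply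
        ⟨m.hom.c⟩
  rw [Adjunction.homEquiv_unit] at key
  exact congrArg (fun c => (InducedCategory.homMk
    (⟨m.hom.base, c⟩ : Z.toPresheafedSpace ⟶ X.toPresheafedSpace) : Z ⟶ X))
    (congrArg (fun k => k.hom) key)

theorem L.stalkMap_lift {Z X : RSpace.{u}} (m : Z ⟶ X)
    (h : ∀ z, IsLocalRing (X.presheaf.stalk (m.hom.base z))) (z : Z) :
    (L.incl X).hom.stalkMap ((L.lift m h).hom.base z) ≫ (L.lift m h).hom.stalkMap z =
      (L.lift m h ≫ L.incl X).hom.stalkMap z :=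
  (stalkMap_comp (L.lift m h) (L.incl X) z).symm

theorem L.isIso_stalkMap_lift {Z X : RSpace.{u}} (m : Z ⟶ X)
    (h : ∀ z, IsLocalRing (X.presheaf.stalk (m.hom.base z)))
    (hm : ∀ z, IsIso (m.hom.stalkMap z)) (z : Z) : IsIso ((L.lift m h).hom.stalkMap z) := by
  have h1 := isIso_stalkMap_incl X ((L.lift m h).hom.base z)
  have h2 : IsIso ((L.lift m h ≫ L.incl X).hom.stalkMap z) := (L.lift_incl m h).symm ▸ hm z
  rw [← L.stalkMap_lift] at h2
  exact @IsIso.of_isIso_comp_left _ _ _ _ _ _ _ h1 h2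

theorem L.isLocalMor_lift {Z X : RSpace.{u}} (m : Z ⟶ X)
    (h : ∀ z, IsLocalRing (X.presheaf.stalk (m.hom.base z)))
    (hm : IsLocalMor m) : IsLocalMor (L.lift m h) := by
  intro z
  have h1 := isIso_stalkMap_incl X ((L.lift m h).hom.base z)
  have h2 : IsLocalMor (L.lift m h ≫ L.incl X) := (L.lift_incl m h).symm ▸ hm
  have h3 := h2 z
  rw [← L.stalkMap_lift] at h3
  refine ⟨fun a ha => ?_⟩
  obtain ⟨b, rfl⟩ := ((ConcreteCategory.isIso_iff_bijective
    ((L.incl X).hom.stalkMap ((L.lift m h).hom.base z))).1 h1).2 a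
  exact (h3.map_nonunit b ha).map ((L.incl X).hom.stalkMap ((L.lift m h).hom.base z)).hom

theorem isLocalMor_incl (X : RSpace.{u}) : IsLocalMor (L.incl X) := fun x =>
  have := isIso_stalkMap_incl X x
  isLocalHom_hom_of_isIso _

theorem isLocalRing_stalk_L (X : RSpace.{u}) (x : L X) :
    IsLocalRing ((L X).presheaf.stalk x) :=
  have := isIso_stalkMap_incl X x
  (isLocalRing_iff_of_ringEquiv
    (asIso ((L.incl X).hom.stalkMap x)).ringCatIsoToRingEquiv).1 x.2

theorem isLocalRing_stalk_of_isLocalMor {X Y : RSpace.{u}} (f : X ⟶ Y) (hf : IsLocalMor f)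
    (x : X) (hx : IsLocalRing (X.presheaf.stalk x)) :
    IsLocalRing (Y.presheaf.stalk (f.hom.base x)) :=
  have := hf x
  isLocalRing_of_isLocalHom (f.hom.stalkMap x).hom

theorem L.isEmbedding_lift {Z X : RSpace.{u}} (m : Z ⟶ X)
    (h : ∀ z, IsLocalRing (X.presheaf.stalk (m.hom.base z)))
    (hm : Topology.IsEmbedding m.hom.base) : Topology.IsEmbedding (L.lift m h).hom.base :=
  Topology.IsEmbedding.of_comp (L.lift m h).hom.base.hom.continuous
    (localPointsIncl X).hom.continuous hm

theorem isIso_of_isIso_stalkMap {X Y : RSpace.{u}} (f : X ⟶ Y)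
    (hf : Topology.IsEmbedding f.hom.base) (hs : Function.Surjective f.hom.base)
    (h : ∀ x, IsIso (f.hom.stalkMap x)) : IsIso f := by
  have := SheafedSpace.IsOpenImmersion.of_stalk_iso f
    ⟨hf, by rw [hs.range_eq]; exact isOpen_univ⟩
  have : Epi f.hom.base := (TopCat.epi_iff_surjective _).2 hs
  exact SheafedSpace.IsOpenImmersion.to_iso f

/-! ### The prime spectrum as the space of local points of `F(A)` -/

theorem isLocalRing_stalk_specToF (A : CommRingCat.{u}) (P : ofScheme (Spec A)) :
    IsLocalRing ((F (RingCat.of A)).presheaf.stalk ((specToF A).hom.base P)) :=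
  (range_specToF A).le ⟨P, rfl⟩

theorem exists_iso_L_F (A : CommRingCat.{u}) :
    ∃ e : ofScheme (Spec A) ≅ L (F (RingCat.of A)), e.hom ≫ L.incl _ = specToF A := by
  let m := L.lift (specToF A) (isLocalRing_stalk_specToF A)
  have : IsIso m := isIso_of_isIso_stalkMap m (L.isEmbedding_lift _ _ (isEmbedding_specToF A))
    (fun x => by
      obtain ⟨P, hP⟩ := (range_specToF A).ge x.2
      exact ⟨P, Subtype.ext hP⟩)
    (L.isIso_stalkMap_lift _ _ (isIso_stalkMap_specToF A))
  exact ⟨asIso m, L.lift_incl _ _⟩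

end FSch

namespace FSch

/-! ## Ringed spaces with commutative rings of sections -/

/-- The functor from presheafed spaces of commutative rings to presheafed spaces of rings. -/
abbrev forgetComm : PresheafedSpace CommRingCat.{u} ⥤ PresheafedSpace RingCat.{u} :=
  (forget₂ CommRingCat.{u} RingCat.{u}).mapPresheaf

/-- The commutative ring structure on a ring of sections. -/
abbrev commRingSections (Z : RSpace.{u})
    (h : ∀ (U : Opens Z) (s t : Z.presheaf.obj (op U)), s * t = t * s) (U : (Opens Z)ᵒᵖ) :
    CommRing (Z.presheaf.obj U) :=
  { (inferInstance : Ring (Z.presheaf.obj U)) with mul_comm := h U.unop }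

/-- A ringed space whose rings of sections are commutative, as a presheafed space of commutative
rings. -/
def toComm (Z : RSpace.{u}) (h : ∀ (U : Opens Z) (s t : Z.presheaf.obj (op U)), s * t = t * s) :
    PresheafedSpace CommRingCat.{u} where
  carrier := Z.carrier
  presheaf :=
    { obj := fun U => @CommRingCat.of (Z.presheaf.obj U) (commRingSections Z h U)
      map := fun {U V} i => @CommRingCat.ofHom (Z.presheaf.obj U) (Z.presheaf.obj V)
        (commRingSections Z h U) (commRingSections Z h V) (Z.presheaf.map i).hom
      map_id := fun U => CommRingCat.hom_ext (congrArg RingCat.Hom.hom (Z.presheaf.map_id U))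
      map_comp := fun i j =>
        CommRingCat.hom_ext (congrArg RingCat.Hom.hom (Z.presheaf.map_comp i j)) }

/-- Morphisms of ringed spaces with commutative rings of sections. -/
def commHom {P Q : PresheafedSpace CommRingCat.{u}} (m : forgetComm.obj P ⟶ forgetComm.obj Q) :
    P ⟶ Q where
  base := m.base
  c :=
    { app := fun U => CommRingCat.ofHom (m.c.app U).hom
      naturality := fun _ _ i =>
        CommRingCat.hom_ext (congrArg RingCat.Hom.hom (m.c.naturality i)) }

/-- The stalks do not depend on whether the rings of sections are regarded as commutative rings. -/
def stalkForgetIso (P : PresheafedSpace CommRingCat.{u}) (x : P) :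
    (forget₂ CommRingCat.{u} RingCat.{u}).obj (P.presheaf.stalk x) ≅
      (forgetComm.obj P).presheaf.stalk x :=
  preservesColimitIso (forget₂ CommRingCat.{u} RingCat.{u})
    ((OpenNhds.inclusion x).op ⋙ P.presheaf)

theorem germ_stalkForgetIso (P : PresheafedSpace CommRingCat.{u}) (x : P) (U : Opens P)
    (hU : x ∈ U) :
    (forget₂ CommRingCat.{u} RingCat.{u}).map (P.presheaf.germ U x hU) ≫ (stalkForgetIso P x).hom =
      (forgetComm.obj P).presheaf.germ U x hU :=
  ι_preservesColimitIso_hom (forget₂ CommRingCat.{u} RingCat.{u})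
    ((OpenNhds.inclusion x).op ⋙ P.presheaf) (op ⟨U, hU⟩)

theorem stalkForgetIso_naturality {P Q : PresheafedSpace CommRingCat.{u}} (m : P ⟶ Q) (x : P)
    (a : Q.presheaf.stalk (m.base x)) :
    (stalkForgetIso P x).hom.hom ((m.stalkMap x).hom a) =
      ((forgetComm.map m).stalkMap x).hom ((stalkForgetIso Q (m.base x)).hom.hom a) := by
  obtain ⟨U, hU, s, rfl⟩ := Q.presheaf.exists_germ_eq a
  have h1 := PresheafedSpace.stalkMap_germ_apply m U x hU s
  have h2 := PresheafedSpace.stalkMap_germ_apply (forgetComm.map m) U x hU s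
  have h3 {P : PresheafedSpace CommRingCat.{u}} (x : P) (U : Opens P) (hU : x ∈ U)
      (s : P.presheaf.obj (op U)) := RingHom.congr_fun (congrArg RingCat.Hom.hom
        (germ_stalkForgetIso P x U hU)) s
  refine (congrArg (stalkForgetIso P x).hom.hom h1).trans ?_
  refine (h3 x _ hU _).trans ?_
  refine h2.symm.trans ?_
  exact congrArg ((forgetComm.map m).stalkMap x).hom (h3 _ U hU s).symm

/-- The elementwise form of `stalkForgetIso`. -/
def stalkForgetEquiv (P : PresheafedSpace CommRingCat.{u}) (x : P) :
    P.presheaf.stalk x ≃+* (forgetComm.obj P).presheaf.stalk x :=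
  (stalkForgetIso P x).ringCatIsoToRingEquiv

/-- Lets bijectivity and reflection of units pass between the two versions of the stalk map. -/
theorem stalkMap_commHom {P Q : PresheafedSpace CommRingCat.{u}}
    (m : forgetComm.obj P ⟶ forgetComm.obj Q) (x : P) :
    ⇑((commHom m).stalkMap x).hom =
      (stalkForgetEquiv P x).symm ∘ (m.stalkMap x).hom ∘ stalkForgetEquiv Q (m.base x) :=
  funext fun a => (RingEquiv.eq_symm_apply _).2 (stalkForgetIso_naturality (commHom m) x a)

theorem isIso_stalkMap_commHom {P Q : PresheafedSpace CommRingCat.{u}}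
    (m : forgetComm.obj P ⟶ forgetComm.obj Q) (x : P) [IsIso (m.stalkMap x)] :
    IsIso ((commHom m).stalkMap x) := by
  rw [ConcreteCategory.isIso_iff_bijective]
  change Function.Bijective ((commHom m).stalkMap x).hom
  rw [stalkMap_commHom]
  exact (RingEquiv.bijective _).comp (((ConcreteCategory.isIso_iff_bijective
    (m.stalkMap x)).1 inferInstance).comp (RingEquiv.bijective _))

theorem isLocalHom_stalkMap_commHom {P Q : PresheafedSpace CommRingCat.{u}}
    (m : forgetComm.obj P ⟶ forgetComm.obj Q) (x : P) (h : IsLocalHom (m.stalkMap x).hom) :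
    IsLocalHom ((commHom m).stalkMap x).hom := by
  refine ⟨fun a ha => ?_⟩
  rw [stalkMap_commHom] at ha
  exact (MulEquiv.isUnit_map (stalkForgetEquiv Q (m.base x))).1
    (h.map_nonunit _ ((MulEquiv.isUnit_map (stalkForgetEquiv P x).symm).1 ha))

/-- A ringed space with commutative rings of sections and local stalks, as a locally ringed
space. -/
def toLRS (Z : RSpace.{u}) (h : ∀ (U : Opens Z) (s t : Z.presheaf.obj (op U)), s * t = t * s)
    (hl : ∀ z : Z, IsLocalRing (Z.presheaf.stalk z)) : LocallyRingedSpace.{u} where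
  toPresheafedSpace := toComm Z h
  IsSheaf := (TopCat.Presheaf.isSheaf_iff_isSheaf_comp (forget CommRingCat.{u}) _).2
    ((TopCat.Presheaf.isSheaf_iff_isSheaf_comp (forget RingCat.{u}) Z.presheaf).1 Z.IsSheaf)
  isLocalRing x := (isLocalRing_iff_of_ringEquiv (stalkForgetEquiv (toComm Z h) x)).2 (hl x)

/-! ## Commutative F-schemes -/

theorem CFSch.exists_chart (X : CFSch.{u}) (x : X.toRSpace) :
    ∃ (A : CommRingCat.{u}) (j : F (RingCat.of A) ⟶ X.toRSpace),
      SheafedSpace.IsOpenImmersion j ∧ x ∈ Set.range j.hom.base := by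
  obtain ⟨U, hx, A, ⟨φ⟩⟩ := X.hasCommCover x
  let j : F (RingCat.of A) ⟶ X.toRSpace :=
    φ.inv ≫ X.toRSpace.ofRestrict U.isOpenEmbedding
  have : SheafedSpace.IsOpenImmersion φ.inv := SheafedSpace.IsOpenImmersion.of_isIso _
  have : SheafedSpace.IsOpenImmersion (X.toRSpace.ofRestrict U.isOpenEmbedding) :=
    SheafedSpace.IsOpenImmersion.ofRestrict _ _
  refine ⟨A, j, SheafedSpace.IsOpenImmersion.comp _ _, φ.hom.hom.base ⟨x, hx⟩, ?_⟩
  have h := congrArg (fun k : X.toRSpace.restrict U.isOpenEmbedding ⟶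
    X.toRSpace.restrict U.isOpenEmbedding => k.hom.base ⟨x, hx⟩) φ.hom_inv_id
  exact congrArg Subtype.val h

theorem CFSch.stalk_mul_comm (X : CFSch.{u}) (x : X.toRSpace) (a b : X.toRSpace.presheaf.stalk x) :
    a * b = b * a := by
  obtain ⟨A, j, hj, 𝒮, rfl⟩ := X.exists_chart x
  have h : IsIso (j.hom.stalkMap 𝒮) := inferInstance
  have hi := ((ConcreteCategory.isIso_iff_bijective (j.hom.stalkMap 𝒮)).1 h).1
  refine hi ((map_mul (j.hom.stalkMap 𝒮).hom a b).trans
    (Eq.trans ?_ (map_mul (j.hom.stalkMap 𝒮).hom b a).symm))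
  refine (stalkEquiv 𝒮).injective ?_
  rw [map_mul, map_mul]
  exact 𝒮.mul_comm (fun x y : A => mul_comm x y) _ _

/-- Sections are determined by their germs, and the stalks of `L(X)` are stalks of `X`, which are
rings `A_𝒮` with `A` commutative. -/
theorem CFSch.sections_mul_comm (X : CFSch.{u}) (U : Opens (L X.toRSpace))
    (s t : (L X.toRSpace).presheaf.obj (op U)) : s * t = t * s := by
  refine TopCat.Presheaf.section_ext (L X.toRSpace).sheaf U _ _ fun x hx => ?_
  have h := isIso_stalkMap_incl X.toRSpace x
  have hs := ((ConcreteCategory.isIso_iff_bijective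
    ((L.incl X.toRSpace).hom.stalkMap x)).1 h).2
  have hc (a b : (L X.toRSpace).presheaf.stalk x) : a * b = b * a := by
    obtain ⟨a, rfl⟩ := hs a
    obtain ⟨b, rfl⟩ := hs b
    refine (map_mul ((L.incl X.toRSpace).hom.stalkMap x).hom a b).symm.trans ?_
    refine Eq.trans ?_ (map_mul ((L.incl X.toRSpace).hom.stalkMap x).hom b a)
    exact congrArg _ (X.stalk_mul_comm _ a b)
  refine (map_mul ((L X.toRSpace).presheaf.germ U x hx).hom s t).trans ?_
  exact (hc _ _).trans (map_mul ((L X.toRSpace).presheaf.germ U x hx).hom t s).symm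

/-- The space of local points of a commutative F-scheme as a locally ringed space. -/
def CFSch.localLRS (X : CFSch.{u}) : LocallyRingedSpace.{u} :=
  toLRS (L X.toRSpace) X.sections_mul_comm (isLocalRing_stalk_L X.toRSpace)

/-- Local morphisms of ringed spaces as morphisms of locally ringed spaces. -/
def lrsHom {Y Z : LocallyRingedSpace.{u}}
    (m : forgetComm.obj Y.toPresheafedSpace ⟶ forgetComm.obj Z.toPresheafedSpace)
    (hm : ∀ y, IsLocalHom (m.stalkMap y).hom) : Y ⟶ Z :=
  ⟨commHom m, fun y => isLocalHom_stalkMap_commHom m y (hm y)⟩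

theorem isOpenImmersion_lrsHom {Y Z : LocallyRingedSpace.{u}}
    (m : forgetComm.obj Y.toPresheafedSpace ⟶ forgetComm.obj Z.toPresheafedSpace)
    (hm : ∀ y, IsLocalHom (m.stalkMap y).hom) (ho : Topology.IsOpenEmbedding m.base)
    (hi : ∀ y, IsIso (m.stalkMap y)) : LocallyRingedSpace.IsOpenImmersion (lrsHom m hm) :=
  SheafedSpace.IsOpenImmersion.of_stalk_iso (lrsHom m hm).toShHom ho
    (H := fun y => have := hi y; isIso_stalkMap_commHom m y)

/-- Compose `Spec(A) → F(A)` with an open chart `F(A) → X` and lift the result to `L(X)`; the stalk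
maps stay isomorphisms. -/
theorem CFSch.exists_spec_chart (X : CFSch.{u}) (x : L X.toRSpace) :
    ∃ (A : CommRingCat.{u}) (m : ofScheme (Spec A) ⟶ L X.toRSpace),
      x ∈ Set.range m.hom.base ∧ Topology.IsOpenEmbedding m.hom.base ∧
        ∀ P, IsIso (m.hom.stalkMap P) := by
  obtain ⟨A, j, hj, hx⟩ := X.exists_chart x.1
  let f := specToF A ≫ j
  have hs (P) : IsIso (f.hom.stalkMap P) := by
    have h1 := isIso_stalkMap_specToF A P
    have h2 : IsIso (j.hom.stalkMap ((specToF A).hom.base P)) := inferInstance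
    rw [stalkMap_comp]
    exact @IsIso.comp_isIso _ _ _ _ _ _ _ h2 h1
  have hl (P) : IsLocalRing (X.toRSpace.presheaf.stalk (f.hom.base P)) := by
    have h2 : IsIso (j.hom.stalkMap ((specToF A).hom.base P)) := inferInstance
    exact (isLocalRing_iff_of_ringEquiv (@asIso _ _ _ _
      (j.hom.stalkMap ((specToF A).hom.base P)) h2).ringCatIsoToRingEquiv).2
      (isLocalRing_stalk_specToF A P)
  have he : Topology.IsEmbedding f.hom.base :=
    hj.base_open.isEmbedding.comp (isEmbedding_specToF A)
  let m := L.lift f hl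
  -- Openness comes from here: a local point of `X` in the chart is a local point of `F(A)`, hence
  -- given by a prime ideal.
  have hr : Set.range m.hom.base = (localPointsIncl X.toRSpace) ⁻¹' (Set.range j.hom.base) := by
    ext y
    constructor
    · rintro ⟨P, rfl⟩
      exact ⟨_, rfl⟩
    · rintro ⟨𝒮, h𝒮⟩
      have h2 : IsIso (j.hom.stalkMap 𝒮) := inferInstance
      have h3 : IsLocalRing (X.toRSpace.presheaf.stalk (j.hom.base 𝒮)) := h𝒮 ▸ y.2
      have h4 := (isLocalRing_iff_of_ringEquiv (@asIso _ _ _ _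
        (j.hom.stalkMap 𝒮) h2).ringCatIsoToRingEquiv).1 h3
      obtain ⟨P, rfl⟩ := (range_specToF A).ge h4
      exact ⟨P, Subtype.ext h𝒮⟩
  have ho : Topology.IsOpenEmbedding m.hom.base :=
    ⟨L.isEmbedding_lift f hl he, by
      rw [hr]
      exact hj.base_open.isOpen_range.preimage (localPointsIncl X.toRSpace).hom.continuous⟩
  exact ⟨A, m, (Set.ext_iff.1 hr x).2 hx, ho, L.isIso_stalkMap_lift f hl hs⟩

theorem CFSch.exists_affine_chart (X : CFSch.{u}) (x : X.localLRS) :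
    ∃ (R : CommRingCat) (f : Spec.toLocallyRingedSpace.obj (op R) ⟶ X.localLRS),
      x ∈ Set.range f.base ∧ LocallyRingedSpace.IsOpenImmersion f := by
  obtain ⟨A, m, hx, ho, hi⟩ := X.exists_spec_chart x
  have hl (P) : IsLocalHom (m.hom.stalkMap P).hom :=
    @isLocalHom_hom_of_isIso _ _ (m.hom.stalkMap P) (hi P)
  exact ⟨A, lrsHom (Y := Spec.toLocallyRingedSpace.obj (op A)) (Z := X.localLRS) m.hom hl, hx,
    isOpenImmersion_lrsHom (Y := Spec.toLocallyRingedSpace.obj (op A)) (Z := X.localLRS)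
      m.hom hl ho hi⟩

/-- The space of local points of a commutative F-scheme as a scheme. -/
def CFSch.localScheme (X : CFSch.{u}) : Scheme.{u} :=
  LocallyRingedSpace.IsOpenImmersion.scheme X.localLRS X.exists_affine_chart

/-! ### Functoriality of the space of local points -/

theorem CFSch.isLocalRing_stalk_map {X Y : CFSch.{u}} (g : X ⟶ Y) (x : L X.toRSpace) :
    IsLocalRing (Y.toRSpace.presheaf.stalk ((L.incl X.toRSpace ≫ g.toHom).hom.base x)) :=
  isLocalRing_stalk_of_isLocalMor g.toHom g.isLocal _ x.2

/-- The restriction of a morphism of commutative F-schemes to local points. -/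
def L.map {X Y : CFSch.{u}} (g : X ⟶ Y) : L X.toRSpace ⟶ L Y.toRSpace :=
  L.lift (L.incl X.toRSpace ≫ g.toHom) (CFSch.isLocalRing_stalk_map g)

theorem L.map_incl {X Y : CFSch.{u}} (g : X ⟶ Y) :
    L.map g ≫ L.incl Y.toRSpace = L.incl X.toRSpace ≫ g.toHom :=
  L.lift_incl _ _

theorem L.map_id (X : CFSch.{u}) : L.map (𝟙 X) = 𝟙 (L X.toRSpace) := by
  rw [← cancel_mono (L.incl X.toRSpace), L.map_incl, Category.id_comp]
  exact Category.comp_id _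

theorem L.map_comp {X Y Z : CFSch.{u}} (f : X ⟶ Y) (g : Y ⟶ Z) :
    L.map (f ≫ g) = L.map f ≫ L.map g := by
  rw [← cancel_mono (L.incl Z.toRSpace), L.map_incl, Category.assoc, L.map_incl,
    ← Category.assoc, L.map_incl, Category.assoc]
  rfl

/-- The functor which sends a commutative F-scheme to its space of local points. -/
def localSchemeFunctor : CFSch.{u} ⥤ Scheme.{u} where
  obj X := X.localScheme
  map {X Y} g := Scheme.Hom.mk (X := X.localScheme) (Y := Y.localScheme)
    (lrsHom (Y := X.localLRS) (Z := Y.localLRS) (L.map g).hom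
      (L.isLocalMor_lift _ _ (isLocalMor_comp (isLocalMor_incl _) g.isLocal)))
  -- Both functor laws are transferred from the maps `L.map` of ringed spaces, since a morphism of
  -- schemes is determined by its underlying morphism.
  map_id X := congrArg (Scheme.Hom.mk (X := X.localScheme) (Y := X.localScheme))
    (LocallyRingedSpace.Hom.ext' (congrArg (fun k : L X.toRSpace ⟶ L X.toRSpace =>
      commHom (P := X.localLRS.toPresheafedSpace) (Q := X.localLRS.toPresheafedSpace) k.hom)
      (L.map_id X)))
  map_comp {X _ Z} f g := congrArg (Scheme.Hom.mk (X := X.localScheme) (Y := Z.localScheme))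
    (LocallyRingedSpace.Hom.ext' (congrArg (fun k : L X.toRSpace ⟶ L Z.toRSpace =>
      commHom (P := X.localLRS.toPresheafedSpace) (Q := Z.localLRS.toPresheafedSpace) k.hom)
      (L.map_comp f g)))

end FSch

end

theorem mainTheorem5 :
    (∃ f : ∀ A : CommRingCat.{u},
        FSch.ofScheme (Spec A) ⟶ FSch.F ((forget₂ CommRingCat.{u} RingCat.{u}).obj A),
      (∀ A : CommRingCat.{u}, FSch.IsLocalMor (f A)) ∧
      (∀ (A : CommRingCat.{u}) (P : PrimeSpectrum A),
        FSch.FISystem.first ((f A).hom.base P) = {a : A | a ∉ P.asIdeal}) ∧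
      (∀ (A B : CommRingCat.{u}) (φ : A ⟶ B),
        FSch.ofSchemeMap (Spec.map φ) ≫ f A =
          f B ≫ FSch.F.map ((forget₂ CommRingCat.{u} RingCat.{u}).map φ)) ∧
      (∀ A : CommRingCat.{u},
        ∃ e : FSch.ofScheme (Spec A) ≅
            FSch.L (FSch.F ((forget₂ CommRingCat.{u} RingCat.{u}).obj A)),
          e.hom ≫ FSch.L.incl _ = f A)) ∧
    (∃ (𝓛 : FSch.CFSch.{u} ⥤ Scheme.{u})
        (e : ∀ X : FSch.CFSch.{u}, FSch.ofScheme (𝓛.obj X) ≅ FSch.L X.toRSpace),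
      ∀ (X Y : FSch.CFSch.{u}) (g : X ⟶ Y),
        FSch.ofSchemeMap (𝓛.map g) ≫ (e Y).hom ≫ FSch.L.incl Y.toRSpace =
          (e X).hom ≫ FSch.L.incl X.toRSpace ≫ g.toHom) := by
  refine ⟨⟨FSch.specToF, FSch.isLocalMor_specToF, fun A P => FSch.first_primeSystem P,
    fun A B φ => FSch.specToF_naturality φ, FSch.exists_iso_L_F⟩,
    -- The ringed space underlying the scheme is `L(X)` by definition, so the identity serves as
    -- `e_X` and the required square is `L.map_incl`.
    FSch.localSchemeFunctor, fun X => Iso.refl (FSch.L X.toRSpace), fun X Y g => ?_⟩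
  refine Eq.trans ?_ ((FSch.L.map_incl g).trans (Category.id_comp _).symm)
  exact congrArg (FSch.L.map g ≫ ·) (Category.id_comp (FSch.L.incl Y.toRSpace))
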